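/- **Setting.** Let $f:\mathbb R^n\to\mathbb R$ be $\sigma$-strongly convex ($\sigma>0$, possibly nonsmooth), $A\in\mathbb R^{m\times n}$, $b\in\mathbb R^m$, $\mu>0$. Let $f^*$ be the Fenchel conjugate of $f$ and put $$h(z)=f^*(-A^\top z)-\langle z,b\rangle,\qquad F(z)=h(z)+\mu\|z\|_0+\delta_+(z),\qquad \ell_h=\|A\|^2/\sigma,$$ where $\|A\|$ is the Frobenius norm, $\|z\|_0$ is the number of nonzero entries of $z$, and $\delta_+(z)=0$ if $z\ge 0$, $\delta_+(z)=+\infty$ otherwise. For a locally Lipschitz map $\Phi$ let $\partial_C\Phi(x)$ be Clarke's generalized Jacobian (the convex hull of all limits of Jacobians $J\Phi(x^k)$ at differentiability points $x^k\to x$). $\Phi$ is *semismooth* if it is locally Lipschitz, directionally differentiable, and at every $x$, $\Phi(x+d)-\Phi(x)-Hd=o(\|d\|)$ as $d\to0$, uniformly in $H\in\partial_C\Phi(x+d)$; it is *strongly semismooth* if $o(\|d\|)$ can be replaced by $O(\|d\|^2)$. Put $$\widehat\partial^2h(z)=\{AQA^\top: Q\in\partial_C(\nabla f^*)(-A^\top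 z)\}.$$ For an index set $T$, $x_T$ denotes the subvector and $H_T$ the principal submatrix indexed by $T$, $\overline T$ is the complement of $T$, and $\nabla_Th(z)=(\nabla h(z))_T$. **Method (SGSN).** Fix $\tau\in(0,1/\ell_h)$ (any $\tau>0$ if $\ell_h=0$) and $c_1,c_2,\gamma>0$, and start from any $z^0\in\mathbb R^m$. Given $z^k$, let $T_k=\{i:[z^k-\tau\nabla h(z^k)]_i>\sqrt{2\tau\mu}\}$ and let $v^k_{T_k}=[z^k-\tau\nabla h(z^k)]_{T_k}$, $v^k_{\overline T_k}=0$. Choose any $H^k\in\widehat\partial^2h(v^k)$ and any solution $d^k_{T_k}$ of $$(H^k_{T_k}+\gamma\|\nabla_{T_k}h(v^k)\|I)\,d^k_{T_k}=-\nabla_{T_k}h(v^k).$$ Let $\alpha_k=\min\{1,\beta_k\}$, where $\beta_k=1$ if $d^k_{T_k}\ge0$ and $\beta_k=\min\{-v^k_i/d^k_i: i\in T_k,\ d^k_i<0\}$ otherwise; let $\tilde z^{k+1}_{T_k}=v^k_{T_k}+\alpha_kd^k_{T_k}$ and $\tilde z^{k+1}_{\overline T_k}=0$. Put $z^{k+1}=\tilde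 z^{k+1}$ if both $$F(v^k)-F(\tilde z^{k+1})\ge c_1\|\tilde z^{k+1}-v^k\|^2\quad\text{and}\quad\|\nabla_{T_k}h(\tilde z^{k+1})\|\le c_2\|\tilde z^{k+1}-v^k\|$$ hold, and $z^{k+1}=v^k$ otherwise. **Theorem.** Let $(z^k)$ be a sequence generated by SGSN. Assume that $(z^k)$ is bounded, that $\nabla f^*$ is semismooth, and that $(z^k)$ has an accumulation point $z^*$ such that, with $S^*=\{i:z^*_i\ne0\}$, $d^\top H_{S^*}d>0$ for all $H\in\widehat\partial^2h(z^*)$ and all $d\in\mathbb R^{|S^*|}\setminus\{0\}$. Then: 1. There are $\varepsilon,\eta_3,\eta_4>0$ such that $$\text{every eigenvalue of }H_{S^*}\text{ lies in }[\eta_3,\eta_4]\quad\text{for all }H\in\widehat\partial^2h(z)\text{ and all }z\text{ with }\|z-z^*\|<\varepsilon.\tag{$*$}$$ 2. Let $\varepsilon,\eta_3,\eta_4>0$ be any numbers satisfying $(*)$. If $c_1\le\eta_3/4$ and $c_2\ge\ell_h+\eta_4+1$, then the whole sequence $(z^k)$ converges to $z^*$ and $$\|z^{k+1}-z^*\|=o(\|z^k-z^*\|)\qquad(k\to\infty).$$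 If moreover $\nabla f^*$ is strongly semismooth, then $\|z^{k+1}-z^*\|=O(\|z^k-z^*\|^2)$. -/

import Mathlib

open Set Filter Topology

namespace SGSN

noncomputable section

/-- Fenchel conjugate `f* y = sup_x (⟪y, x⟫ - f x)`. For a finite strongly convex `f` the supremum is
finite at every `y`, so the real-valued supremum is the usual conjugate. -/
def fenchelConj {n : ℕ} (f : EuclideanSpace ℝ (Fin n) → ℝ) (y : EuclideanSpace ℝ (Fin n)) : ℝ :=
  ⨆ x : EuclideanSpace ℝ (Fin n), (inner ℝ y x - f x)

/-- The gradient map `∇ f*` of the conjugate. -/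
def gradConj {n : ℕ} (f : EuclideanSpace ℝ (Fin n) → ℝ) :
    EuclideanSpace ℝ (Fin n) → EuclideanSpace ℝ (Fin n) :=
  gradient (fenchelConj f)

/-- Jacobian matrix of `Φ` at `x` (meaningful where `Φ` is differentiable). -/
def jacobianMatrix {p q : ℕ} (Φ : EuclideanSpace ℝ (Fin p) → EuclideanSpace ℝ (Fin q))
    (x : EuclideanSpace ℝ (Fin p)) : Matrix (Fin q) (Fin p) ℝ :=
  Matrix.of fun i j => fderiv ℝ Φ x (EuclideanSpace.single j 1) i

/-- Clarke's generalized Jacobian: the convex hull of all limits of Jacobians along sequences of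
differentiability points converging to `x`. -/
def clarkeJacobian {p q : ℕ} (Φ : EuclideanSpace ℝ (Fin p) → EuclideanSpace ℝ (Fin q))
    (x : EuclideanSpace ℝ (Fin p)) : Set (Matrix (Fin q) (Fin p) ℝ) :=
  convexHull ℝ {V | ∃ u : ℕ → EuclideanSpace ℝ (Fin p),
    (∀ k, DifferentiableAt ℝ Φ (u k)) ∧ Tendsto u atTop (𝓝 x) ∧
      Tendsto (fun k => jacobianMatrix Φ (u k)) atTop (𝓝 V)}

/-- All one-sided directional derivatives of `Φ` exist. -/
def DirectionallyDifferentiable {p q : ℕ}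
    (Φ : EuclideanSpace ℝ (Fin p) → EuclideanSpace ℝ (Fin q)) : Prop :=
  ∀ x d : EuclideanSpace ℝ (Fin p), ∃ L : EuclideanSpace ℝ (Fin q),
    Tendsto (fun t : ℝ => t⁻¹ • (Φ (x + t • d) - Φ x)) (𝓝[>] 0) (𝓝 L)

/-- Semismoothness: locally Lipschitz, directionally differentiable, and at every `x`,
`Φ (x + d) - Φ x - H d = o(‖d‖)` uniformly in `H ∈ ∂_C Φ (x + d)`. -/
def Semismooth {p q : ℕ} (Φ : EuclideanSpace ℝ (Fin p) → EuclideanSpace ℝ (Fin q)) : Prop :=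
  LocallyLipschitz Φ ∧ DirectionallyDifferentiable Φ ∧
    ∀ x : EuclideanSpace ℝ (Fin p), ∀ ε : ℝ, 0 < ε → ∃ δ : ℝ, 0 < δ ∧
      ∀ d : EuclideanSpace ℝ (Fin p), ‖d‖ < δ → ∀ H ∈ clarkeJacobian Φ (x + d),
        ‖Φ (x + d) - Φ x - Matrix.toEuclideanLin H d‖ ≤ ε * ‖d‖

/-- Strong semismoothness: the remainder in the semismoothness condition is `O(‖d‖²)`. -/
def StronglySemismooth {p q : ℕ}
    (Φ : EuclideanSpace ℝ (Fin p) → EuclideanSpace ℝ (Fin q)) : Prop :=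
  LocallyLipschitz Φ ∧ DirectionallyDifferentiable Φ ∧
    ∀ x : EuclideanSpace ℝ (Fin p), ∃ C δ : ℝ, 0 < δ ∧
      ∀ d : EuclideanSpace ℝ (Fin p), ‖d‖ < δ → ∀ H ∈ clarkeJacobian Φ (x + d),
        ‖Φ (x + d) - Φ x - Matrix.toEuclideanLin H d‖ ≤ C * ‖d‖ ^ 2

/-- Smooth part of the dual objective: `h z = f*(-Aᵀ z) - ⟪z, b⟫`. -/
def dualSmooth {m n : ℕ} (f : EuclideanSpace ℝ (Fin n) → ℝ) (A : Matrix (Fin m) (Fin n) ℝ)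
    (b : EuclideanSpace ℝ (Fin m)) (z : EuclideanSpace ℝ (Fin m)) : ℝ :=
  fenchelConj f (-(Matrix.toEuclideanLin A.transpose z)) - inner ℝ z b

/-- `ℓ_h = ‖A‖² / σ`, with the Frobenius norm of `A`. -/
def lipConst {m n : ℕ} (A : Matrix (Fin m) (Fin n) ℝ) (σ : ℝ) : ℝ :=
  (∑ i, ∑ j, A i j ^ 2) / σ

/-- Support set of `z`. -/
def supp {m : ℕ} (z : EuclideanSpace ℝ (Fin m)) : Finset (Fin m) :=
  Finset.univ.filter fun i => z i ≠ 0

/-- The function equal to `0` on the nonnegative orthant and `+∞` elsewhere. -/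
def nonnegBarrier {m : ℕ} (z : EuclideanSpace ℝ (Fin m)) : EReal :=
  if ∀ i, 0 ≤ z i then 0 else ⊤

/-- `g z = μ ‖z‖₀ + δ₊(z)`. -/
def sparseReg {m : ℕ} (μ : ℝ) (z : EuclideanSpace ℝ (Fin m)) : EReal :=
  ((μ * ((supp z).card : ℝ) : ℝ) : EReal) + nonnegBarrier z

/-- The dual objective (to be minimized) `F = h + g`, with values in `(-∞, +∞]`. -/
def dualObj {m n : ℕ} (f : EuclideanSpace ℝ (Fin n) → ℝ) (A : Matrix (Fin m) (Fin n) ℝ)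
    (b : EuclideanSpace ℝ (Fin m)) (μ : ℝ) (z : EuclideanSpace ℝ (Fin m)) : EReal :=
  (dualSmooth f A b z : EReal) + sparseReg μ z

/-- The set `{A Q Aᵀ | Q ∈ ∂_C (∇f*)(-Aᵀ z)}` of generalized Hessians of `h` at `z`. -/
def genHessian {m n : ℕ} (f : EuclideanSpace ℝ (Fin n) → ℝ) (A : Matrix (Fin m) (Fin n) ℝ)
    (z : EuclideanSpace ℝ (Fin m)) : Set (Matrix (Fin m) (Fin m) ℝ) :=
  {H | ∃ Q ∈ clarkeJacobian (gradConj f) (-(Matrix.toEuclideanLin A.transpose z)),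
    H = A * Q * A.transpose}

/-- The subvector `x_T`. -/
def subvec {m : ℕ} (T : Finset (Fin m)) (x : EuclideanSpace ℝ (Fin m)) : EuclideanSpace ℝ T :=
  WithLp.toLp 2 fun i : T => x i

/-- The principal submatrix `H_T`. -/
def submat {m : ℕ} (T : Finset (Fin m)) (H : Matrix (Fin m) (Fin m) ℝ) : Matrix T T ℝ :=
  H.submatrix (fun i : T => (i : Fin m)) (fun i : T => (i : Fin m))

/-- Extension by zero of the coordinates in `T`: keeps `x_T` and puts `0` off `T`. -/
def keepOn {m : ℕ} (T : Finset (Fin m)) (x : EuclideanSpace ℝ (Fin m)) :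
    EuclideanSpace ℝ (Fin m) :=
  WithLp.toLp 2 fun i => if i ∈ T then x i else 0

/-- The gradient step `z - τ ∇h(z)`. -/
def gradStep {m n : ℕ} (f : EuclideanSpace ℝ (Fin n) → ℝ) (A : Matrix (Fin m) (Fin n) ℝ)
    (b : EuclideanSpace ℝ (Fin m)) (τ : ℝ) (z : EuclideanSpace ℝ (Fin m)) :
    EuclideanSpace ℝ (Fin m) :=
  z - τ • gradient (dualSmooth f A b) z

/-- The index set `T = {i | [z - τ ∇h(z)]_i > √(2τμ)}`. -/
def activeSet {m n : ℕ} (f : EuclideanSpace ℝ (Fin n) → ℝ) (A : Matrix (Fin m) (Fin n) ℝ)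
    (b : EuclideanSpace ℝ (Fin m)) (μ τ : ℝ) (z : EuclideanSpace ℝ (Fin m)) : Finset (Fin m) :=
  Finset.univ.filter fun i => √(2 * τ * μ) < gradStep f A b τ z i

/-- The proximal gradient iterate `v`: `v_T = [z - τ ∇h(z)]_T`, and `v = 0` off `T`. -/
def proxStep {m n : ℕ} (f : EuclideanSpace ℝ (Fin n) → ℝ) (A : Matrix (Fin m) (Fin n) ℝ)
    (b : EuclideanSpace ℝ (Fin m)) (μ τ : ℝ) (z : EuclideanSpace ℝ (Fin m)) :
    EuclideanSpace ℝ (Fin m) :=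
  keepOn (activeSet f A b μ τ z) (gradStep f A b τ z)

/-- The step length `α = min {1, β}`, where `β = 1` if `d_T ≥ 0` and
`β = min {-v_i / d_i | i ∈ T, d_i < 0}` otherwise. -/
def stepLength {m : ℕ} (T : Finset (Fin m)) (v d : EuclideanSpace ℝ (Fin m)) : ℝ :=
  min 1 (if hN : (T.filter fun i => d i < 0).Nonempty then
    (T.filter fun i => d i < 0).inf' hN fun i => -v i / d i else 1)

/-- The Newton iterate: `v_T + α d_T` on `T`, and `0` off `T`. -/
def newtonStep {m : ℕ} (T : Finset (Fin m)) (v d : EuclideanSpace ℝ (Fin m)) :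
    EuclideanSpace ℝ (Fin m) :=
  keepOn T (v + stepLength T v d • d)

/-- The regularized Newton equation `(H_T + γ ‖∇_T h(v)‖ I) d_T = -∇_T h(v)`. -/
def NewtonEq {m n : ℕ} (f : EuclideanSpace ℝ (Fin n) → ℝ) (A : Matrix (Fin m) (Fin n) ℝ)
    (b : EuclideanSpace ℝ (Fin m)) (γ : ℝ) (T : Finset (Fin m)) (H : Matrix (Fin m) (Fin m) ℝ)
    (v d : EuclideanSpace ℝ (Fin m)) : Prop :=
  Matrix.toEuclideanLin
      (submat T H + (γ * ‖subvec T (gradient (dualSmooth f A b) v)‖) • (1 : Matrix T T ℝ))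
      (subvec T d) =
    -subvec T (gradient (dualSmooth f A b) v)

/-- The two acceptance conditions for a Newton iterate `w`:
`F(v) - F(w) ≥ c₁ ‖w - v‖²` and `‖∇_T h(w)‖ ≤ c₂ ‖w - v‖`. -/
def Accepted {m n : ℕ} (f : EuclideanSpace ℝ (Fin n) → ℝ) (A : Matrix (Fin m) (Fin n) ℝ)
    (b : EuclideanSpace ℝ (Fin m)) (μ c₁ c₂ : ℝ) (T : Finset (Fin m))
    (v w : EuclideanSpace ℝ (Fin m)) : Prop :=
  dualObj f A b μ w + ((c₁ * ‖w - v‖ ^ 2 : ℝ) : EReal) ≤ dualObj f A b μ v ∧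
    ‖subvec T (gradient (dualSmooth f A b) w)‖ ≤ c₂ * ‖w - v‖

/-- One iteration of the method leads from `z` to `z'`, for some choice of the generalized Hessian
`H` and some solution `d` of the Newton equation. -/
def Step {m n : ℕ} (f : EuclideanSpace ℝ (Fin n) → ℝ) (A : Matrix (Fin m) (Fin n) ℝ)
    (b : EuclideanSpace ℝ (Fin m)) (μ τ c₁ c₂ γ : ℝ) (z z' : EuclideanSpace ℝ (Fin m)) : Prop :=
  let T := activeSet f A b μ τ z
  let v := proxStep f A b μ τ z
  ∃ H ∈ genHessian f A v, ∃ d : EuclideanSpace ℝ (Fin m), NewtonEq f A b γ T H v d ∧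
    (Accepted f A b μ c₁ c₂ T v (newtonStep T v d) → z' = newtonStep T v d) ∧
    (¬ Accepted f A b μ c₁ c₂ T v (newtonStep T v d) → z' = v)

/-- `z` is a sequence of iterates of the subspace gradient semismooth Newton method. -/
def IsSequence {m n : ℕ} (f : EuclideanSpace ℝ (Fin n) → ℝ) (A : Matrix (Fin m) (Fin n) ℝ)
    (b : EuclideanSpace ℝ (Fin m)) (μ τ c₁ c₂ γ : ℝ) (z : ℕ → EuclideanSpace ℝ (Fin m)) : Prop :=
  ∀ k, Step f A b μ τ c₁ c₂ γ (z k) (z (k + 1))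

/-- Second-order sufficient condition: `dᵀ H_S d > 0` for every `H` in the set of generalized
Hessians at `zs` and every nonzero `d`, where `S` is the support of `zs`. -/
def SOSC {m n : ℕ} (f : EuclideanSpace ℝ (Fin n) → ℝ) (A : Matrix (Fin m) (Fin n) ℝ)
    (zs : EuclideanSpace ℝ (Fin m)) : Prop :=
  ∀ H ∈ genHessian f A zs, ∀ d : supp zs → ℝ, d ≠ 0 →
    0 < dotProduct d ((submat (supp zs) H).mulVec d)

/-- `η₃` and `η₄` are positive lower and upper bounds for all eigenvalues of `H_S`, where `S` is the
support of `zs` and `H` runs over the generalized Hessians at the points of the open ball of radius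
`ε > 0` around `zs`. -/
def EigenvalueBounds {m n : ℕ} (f : EuclideanSpace ℝ (Fin n) → ℝ) (A : Matrix (Fin m) (Fin n) ℝ)
    (zs : EuclideanSpace ℝ (Fin m)) (ε η₃ η₄ : ℝ) : Prop :=
  0 < ε ∧ 0 < η₃ ∧ 0 < η₄ ∧
    ∀ z ∈ Metric.ball zs ε, ∀ H ∈ genHessian f A z, ∀ l ∈ spectrum ℝ (submat (supp zs) H),
      η₃ ≤ l ∧ l ≤ η₄

end

end SGSN

namespace SGSN

/-! Globally, the method is a descent method. Strong convexity of `f` makes `∇f*` Lipschitz with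
constant 1/σ (`norm_gradConj_sub_le`), hence `∇h` Lipschitz with constant ℓ_h. As τℓ_h < 1, a
proximal step from `z ≥ 0` to `v` lowers `F` by a fixed multiple of ‖v - z‖²
(`realObj_proxStep_le`), and a Newton point is accepted only if it does not undo this. Boundedness
of the iterates then forces v^k - z^k → 0 (`tendsto_proxStep_sub`).

Hard thresholding identifies the support S of the accumulation point z*. Nonzero entries of v^k
exceed √(2τμ), so those of z* are at least √(2τμ) and ∇h(z*) vanishes on S (`limit_of_proxStep`).
Once v is closer to z* than this threshold, the active set equals S (`activeSet_eq_supp`), and the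
iteration is a regularized semismooth Newton method on the subspace of S.

Locally, compactness spreads the second-order condition to a neighbourhood
(`exists_eigenvalueBounds`). The Newton error is then at most (semismooth remainder + O(‖v -
z*‖²))/η₃ (`norm_newton_sub_le`). Quadratic growth of `h` along S (`dualSmooth_growth`) shows that
such a Newton point passes both acceptance tests (`accepted_of_norm_le`). So near z* every iteration
contracts by any prescribed factor: the factor 1/2 turns the accumulation point into a limit,
arbitrary factors give the superlinear rate, and a quadratic remainder gives the quadratic one. -/

/-- A finite strongly convex function on a finite-dimensional space has a minimizer, with quadratic
growth around it. -/
theorem exists_min_of_strongConvexOn {E : Type*} [NormedAddCommGroup E] [NormedSpace ℝ E]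
    [FiniteDimensional ℝ E] {g : E → ℝ} {σ : ℝ} (hσ : 0 < σ) (hg : StrongConvexOn univ σ g) :
    ∃ x₀, ∀ x, g x₀ + σ / 2 * ‖x - x₀‖ ^ 2 ≤ g x := by
  have hcvx : ConvexOn ℝ univ g := UniformConvexOn.convexOn hg fun r => by positivity
  have hcont : Continuous g := continuousOn_univ.1 (hcvx.continuousOn isOpen_univ)
  obtain ⟨C, hC⟩ : ∃ C, ∀ x ∈ Metric.closedBall (0 : E) 1, C ≤ g x := by
    obtain ⟨C, hC⟩ := (isCompact_closedBall (0 : E) 1).bddBelow_image hcont.continuousOn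
    exact ⟨C, fun x hx => hC ⟨x, hx, rfl⟩⟩
  -- Strong convexity on the segment from 0 to x, evaluated at x/‖x‖ where g ≥ C, gives a lower
  -- bound quadratic in ‖x‖.
  have hlow : ∀ x : E, 1 ≤ ‖x‖ →
      (C - |g 0|) * ‖x‖ + σ / 2 * (‖x‖ * (‖x‖ - 1)) ≤ g x := by
    intro x hx
    have hx0 : 0 < ‖x‖ := by linarith
    have h1 := hg.2 (mem_univ x) (mem_univ 0) (inv_nonneg.2 hx0.le)
      (sub_nonneg.2 (inv_le_one_of_one_le₀ hx)) (by ring)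
    have h2 := hC (‖x‖⁻¹ • x + (1 - ‖x‖⁻¹) • (0 : E)) (by
      simp [norm_smul, inv_mul_cancel₀ hx0.ne'])
    have h3 := h2.trans h1
    simp only [smul_eq_mul, sub_zero] at h3
    have h4 := mul_le_mul_of_nonneg_left h3 hx0.le
    have e1 : ‖x‖ * (‖x‖⁻¹ * g x + (1 - ‖x‖⁻¹) * g 0 -
        ‖x‖⁻¹ * (1 - ‖x‖⁻¹) * (σ / 2 * ‖x‖ ^ 2)) =
        g x + (‖x‖ - 1) * g 0 - σ / 2 * (‖x‖ * (‖x‖ - 1)) := by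
      field_simp
    rw [e1] at h4
    have h5 : (‖x‖ - 1) * g 0 ≤ ‖x‖ * |g 0| := by
      calc (‖x‖ - 1) * g 0 ≤ (‖x‖ - 1) * |g 0| := by
            gcongr
            exact le_abs_self _
        _ ≤ ‖x‖ * |g 0| := by gcongr; linarith
    linarith
  have hcoer : ∀ᶠ x in cocompact E, g 0 ≤ g x := by
    have ht : Tendsto (fun x : E => ‖x‖) (cocompact E) atTop := tendsto_norm_cocompact_atTop
    filter_upwards [ht.eventually_ge_atTop 1,
      ht.eventually_ge_atTop (1 + 2 / σ * (|g 0| + |C - (|g 0|)|))] with x h1 h2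
    have h3 := hlow x h1
    have h4 : |g 0| + |C - (|g 0|)| ≤ σ / 2 * (‖x‖ - 1) := by
      have : 2 / σ * (|g 0| + |C - (|g 0|)|) ≤ ‖x‖ - 1 := by linarith
      calc _ = σ / 2 * (2 / σ * (|g 0| + |C - (|g 0|)|)) := by field_simp
        _ ≤ _ := by gcongr
    have h5 := neg_abs_le (C - |g 0|)
    have h6 := le_abs_self (g 0)
    have h7 := abs_nonneg (g 0)
    nlinarith
  obtain ⟨x₀, hx₀⟩ := hcont.exists_forall_le' 0 hcoer
  refine ⟨x₀, fun x => ?_⟩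
  -- Comparing x₀ with t x + (1 - t) x₀ and dividing by t gives growth with constant (1 - t)σ/2;
  -- letting t → 0 recovers the full σ/2.
  have hlim : Tendsto (fun t : ℝ => g x₀ + (1 - t) * (σ / 2 * ‖x - x₀‖ ^ 2)) (𝓝[>] 0)
      (𝓝 (g x₀ + (1 - 0) * (σ / 2 * ‖x - x₀‖ ^ 2))) :=
    Continuous.continuousWithinAt (f := fun t : ℝ => g x₀ + (1 - t) * (σ / 2 * ‖x - x₀‖ ^ 2))
      (by fun_prop)
  rw [sub_zero, one_mul] at hlim
  refine le_of_tendsto hlim ?_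
  filter_upwards [Ioo_mem_nhdsGT (zero_lt_one' ℝ)] with t ht
  have h1 := (hx₀ _).trans (hg.2 (mem_univ x) (mem_univ x₀) ht.1.le (sub_nonneg.2 ht.2.le) (by ring))
  simp only [smul_eq_mul] at h1
  have h2 : t * (g x₀ + (1 - t) * (σ / 2 * ‖x - x₀‖ ^ 2)) ≤ t * g x := by linarith
  exact le_of_mul_le_mul_left h2 ht.1

/-! ### The conjugate of a strongly convex function: differentiability and Lipschitz gradient. -/

section Conjugate

variable {n : ℕ} {f : EuclideanSpace ℝ (Fin n) → ℝ} {σ : ℝ}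

/-- The supremum defining the conjugate is attained, with quadratic growth. -/
theorem exists_conj_maximizer (hσ : 0 < σ) (hf : StrongConvexOn univ σ f)
    (y : EuclideanSpace ℝ (Fin n)) :
    ∃ x₀, fenchelConj f y = inner ℝ y x₀ - f x₀ ∧
      ∀ x, f x₀ - inner ℝ y x₀ + σ / 2 * ‖x - x₀‖ ^ 2 ≤ f x - inner ℝ y x := by
  have hg : StrongConvexOn univ σ fun x => f x - inner ℝ y x := by
    refine ⟨convex_univ, fun x _ x' _ a b ha hb hab => ?_⟩
    have := hf.2 (mem_univ x) (mem_univ x') ha hb hab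
    simp only [inner_add_right, inner_smul_right, smul_eq_mul] at *
    linarith
  obtain ⟨x₀, hx₀⟩ := exists_min_of_strongConvexOn hσ hg
  refine ⟨x₀, ?_, hx₀⟩
  have hle : ∀ x, inner ℝ y x - f x ≤ inner ℝ y x₀ - f x₀ := fun x => by
    have := hx₀ x
    have : 0 ≤ σ / 2 * ‖x - x₀‖ ^ 2 := by positivity
    linarith
  exact le_antisymm (ciSup_le hle) (le_ciSup (f := fun x => inner ℝ y x - f x)
    ⟨_, by rintro _ ⟨x, rfl⟩; exact hle x⟩ x₀)

theorem hasGradientAt_of_quadratic_bound {E : Type*} [NormedAddCommGroup E]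
    [InnerProductSpace ℝ E] [CompleteSpace E] {φ : E → ℝ} {g y : E} {L : ℝ}
    (h : ∀ y', |φ y' - φ y - inner ℝ g (y' - y)| ≤ L * ‖y' - y‖ ^ 2) : HasGradientAt φ g y := by
  rw [hasGradientAt_iff_isLittleO]
  have h1 : (fun y' => φ y' - φ y - inner ℝ g (y' - y)) =O[𝓝 y] fun y' => ‖y' - y‖ ^ 2 :=
    Asymptotics.IsBigO.of_bound L (Eventually.of_forall fun y' => by
      simpa using h y')
  refine h1.trans_isLittleO ?_
  have h2 : (fun x : E => ‖x‖ ^ 2) =o[𝓝 0] fun x => x :=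
    Asymptotics.isLittleO_norm_pow_id one_lt_two
  have h3 : Tendsto (fun y' => y' - y) (𝓝 y) (𝓝 0) := by
    simpa using (tendsto_id (α := E) (x := 𝓝 y)).sub_const y
  exact h2.comp_tendsto h3

/-- Lower bound: x₀ is a competitor in the supremum at y'. Upper bound: test the quadratic growth
around x₀ at the maximizer for y', then absorb the cross term by Young's inequality. -/
theorem conj_quadratic_bounds_of_maximizer (hσ : 0 < σ) (hf : StrongConvexOn univ σ f)
    {y x₀ : EuclideanSpace ℝ (Fin n)} (hy : fenchelConj f y = inner ℝ y x₀ - f x₀)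
    (hx₀ : ∀ x, f x₀ - inner ℝ y x₀ + σ / 2 * ‖x - x₀‖ ^ 2 ≤ f x - inner ℝ y x)
    (y' : EuclideanSpace ℝ (Fin n)) :
    fenchelConj f y + inner ℝ x₀ (y' - y) ≤ fenchelConj f y' ∧
      fenchelConj f y' ≤ fenchelConj f y + inner ℝ x₀ (y' - y) + 1 / (2 * σ) * ‖y' - y‖ ^ 2 := by
  obtain ⟨x₁, hy₁, hx₁⟩ := exists_conj_maximizer hσ hf y'
  rw [hy, hy₁, inner_sub_right, real_inner_comm y' x₀, real_inner_comm y x₀]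
  constructor
  · have := hx₁ x₀
    have : 0 ≤ σ / 2 * ‖x₀ - x₁‖ ^ 2 := by positivity
    linarith
  · have h1 := hx₀ x₁
    have h2 := real_inner_le_norm (y' - y) (x₁ - x₀)
    simp only [inner_sub_left, inner_sub_right] at h2
    have h3 : ‖y' - y‖ * ‖x₁ - x₀‖ ≤ 1 / (2 * σ) * ‖y' - y‖ ^ 2 + σ / 2 * ‖x₁ - x₀‖ ^ 2 := by
      have : 0 ≤ 1 / (2 * σ) * (‖y' - y‖ - σ * ‖x₁ - x₀‖) ^ 2 := by positivity
      have e : 1 / (2 * σ) * (‖y' - y‖ - σ * ‖x₁ - x₀‖) ^ 2 =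
        1 / (2 * σ) * ‖y' - y‖ ^ 2 + σ / 2 * ‖x₁ - x₀‖ ^ 2 - ‖y' - y‖ * ‖x₁ - x₀‖ := by
        field_simp
        ring
      linarith
    linarith

theorem hasGradientAt_of_maximizer (hσ : 0 < σ) (hf : StrongConvexOn univ σ f)
    {y x₀ : EuclideanSpace ℝ (Fin n)} (hy : fenchelConj f y = inner ℝ y x₀ - f x₀)
    (hx₀ : ∀ x, f x₀ - inner ℝ y x₀ + σ / 2 * ‖x - x₀‖ ^ 2 ≤ f x - inner ℝ y x) :
    HasGradientAt (fenchelConj f) x₀ y := by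
  refine hasGradientAt_of_quadratic_bound (L := 1 / (2 * σ)) fun y' => ?_
  obtain ⟨h1, h2⟩ := conj_quadratic_bounds_of_maximizer hσ hf hy hx₀ y'
  rw [abs_le]
  constructor
  · have : 0 ≤ 1 / (2 * σ) * ‖y' - y‖ ^ 2 := by positivity
    linarith
  · linarith

/-- Identifies `∇f*(y)` with the point where the supremum at y is attained, so later estimates can
use its quadratic growth. -/
theorem gradConj_spec (hσ : 0 < σ) (hf : StrongConvexOn univ σ f)
    (y : EuclideanSpace ℝ (Fin n)) :
    fenchelConj f y = inner ℝ y (gradConj f y) - f (gradConj f y) ∧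
      ∀ x, f (gradConj f y) - inner ℝ y (gradConj f y) + σ / 2 * ‖x - gradConj f y‖ ^ 2 ≤
        f x - inner ℝ y x := by
  obtain ⟨x₀, hy, hx₀⟩ := exists_conj_maximizer hσ hf y
  have : gradConj f y = x₀ := (hasGradientAt_of_maximizer hσ hf hy hx₀).gradient
  rw [this]
  exact ⟨hy, hx₀⟩

theorem hasGradientAt_fenchelConj (hσ : 0 < σ) (hf : StrongConvexOn univ σ f)
    (y : EuclideanSpace ℝ (Fin n)) : HasGradientAt (fenchelConj f) (gradConj f y) y :=
  hasGradientAt_of_maximizer hσ hf (gradConj_spec hσ hf y).1 (gradConj_spec hσ hf y).2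

theorem fenchelConj_le (hσ : 0 < σ) (hf : StrongConvexOn univ σ f)
    (y y' : EuclideanSpace ℝ (Fin n)) :
    fenchelConj f y' ≤
      fenchelConj f y + inner ℝ (gradConj f y) (y' - y) + 1 / (2 * σ) * ‖y' - y‖ ^ 2 :=
  (conj_quadratic_bounds_of_maximizer hσ hf (gradConj_spec hσ hf y).1 (gradConj_spec hσ hf y).2
    y').2

/-- Testing the growth around each of the two maximizers at the other one and adding gives σr² ≤ ⟪y
- y', ∇f*(y) - ∇f*(y')⟫, with r the distance of the gradients; Cauchy–Schwarz finishes. -/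
theorem norm_gradConj_sub_le (hσ : 0 < σ) (hf : StrongConvexOn univ σ f)
    (y y' : EuclideanSpace ℝ (Fin n)) :
    ‖gradConj f y - gradConj f y'‖ ≤ 1 / σ * ‖y - y'‖ := by
  have h1 := (gradConj_spec hσ hf y).2 (gradConj f y')
  have h2 := (gradConj_spec hσ hf y').2 (gradConj f y)
  rw [norm_sub_rev] at h1
  have h3 := real_inner_le_norm (y - y') (gradConj f y - gradConj f y')
  simp only [inner_sub_left, inner_sub_right] at h3
  set r := ‖gradConj f y - gradConj f y'‖
  have h4 : σ * r ^ 2 ≤ ‖y - y'‖ * r := by linarith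
  rcases (norm_nonneg (gradConj f y - gradConj f y')).eq_or_lt with h0 | h0
  · rw [show r = 0 from h0.symm]
    positivity
  · have : σ * r ≤ ‖y - y'‖ := le_of_mul_le_mul_right (by linarith) h0
    rw [one_div_mul_eq_div, le_div_iff₀ hσ]
    linarith

theorem lipschitzWith_gradConj (hσ : 0 < σ) (hf : StrongConvexOn univ σ f) :
    LipschitzWith (1 / σ).toNNReal (gradConj f) :=
  LipschitzWith.of_dist_le_mul fun y y' => by
    rw [dist_eq_norm, dist_eq_norm, Real.coe_toNNReal _ (by positivity)]
    exact norm_gradConj_sub_le hσ hf y y'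

end Conjugate

/-! ### Matrices acting on Euclidean spaces, with Frobenius bounds. -/

section EuclideanMatrix

theorem inner_toEuclideanLin_transpose {m n : ℕ} (A : Matrix (Fin m) (Fin n) ℝ)
    (z : EuclideanSpace ℝ (Fin m)) (x : EuclideanSpace ℝ (Fin n)) :
    inner ℝ (Matrix.toEuclideanLin A.transpose z) x = inner ℝ z (Matrix.toEuclideanLin A x) := by
  rw [← LinearMap.adjoint_inner_left, ← Matrix.toEuclideanLin_conjTranspose_eq_adjoint,
    Matrix.conjTranspose_eq_transpose_of_trivial]

theorem norm_toEuclideanLin_sq_le {m n : ℕ} (A : Matrix (Fin m) (Fin n) ℝ)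
    (x : EuclideanSpace ℝ (Fin n)) :
    ‖Matrix.toEuclideanLin A x‖ ^ 2 ≤ (∑ i, ∑ j, A i j ^ 2) * ‖x‖ ^ 2 := by
  rw [EuclideanSpace.norm_sq_eq, EuclideanSpace.norm_sq_eq, Finset.sum_mul]
  refine Finset.sum_le_sum fun i _ => ?_
  simp only [Real.norm_eq_abs, sq_abs]
  exact Finset.sum_mul_sq_le_sq_mul_sq Finset.univ (fun j => A i j) fun j => x j

theorem toEuclideanLin_mul_apply {m n p : ℕ} (A : Matrix (Fin m) (Fin n) ℝ)
    (B : Matrix (Fin n) (Fin p) ℝ) (x : EuclideanSpace ℝ (Fin p)) :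
    Matrix.toEuclideanLin (A * B) x = Matrix.toEuclideanLin A (Matrix.toEuclideanLin B x) := by
  ext i
  simp [Matrix.mulVec_mulVec]

theorem norm_toEuclideanLin_transpose_sq_le {m n : ℕ} (A : Matrix (Fin m) (Fin n) ℝ)
    (z : EuclideanSpace ℝ (Fin m)) :
    ‖Matrix.toEuclideanLin A.transpose z‖ ^ 2 ≤ (∑ i, ∑ j, A i j ^ 2) * ‖z‖ ^ 2 := by
  refine (norm_toEuclideanLin_sq_le _ _).trans_eq ?_
  rw [Finset.sum_comm]
  rfl

end EuclideanMatrix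

/-! ### Subvectors, principal submatrices and extension by zero. -/

section Restriction

variable {m : ℕ} (T : Finset (Fin m))

/-- Extension by zero of a vector indexed by `T`. -/
noncomputable def extendZero (d : EuclideanSpace ℝ T) : EuclideanSpace ℝ (Fin m) :=
  WithLp.toLp 2 fun i => if h : i ∈ T then d ⟨i, h⟩ else 0

theorem sum_extendZero_mul (d : EuclideanSpace ℝ T) (x : Fin m → ℝ) :
    ∑ i, x i * extendZero T d i = ∑ i : T, x i * d i := by
  rw [← Finset.sum_subset (Finset.subset_univ T), ← Finset.sum_coe_sort T]
  · exact Finset.sum_congr rfl fun i _ => by simp [extendZero]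
  · intro i _ hi
    simp [extendZero, hi]

theorem inner_extendZero (d : EuclideanSpace ℝ T) (x : EuclideanSpace ℝ (Fin m)) :
    inner ℝ (extendZero T d) x = inner ℝ d (subvec T x) := by
  simpa [PiLp.inner_apply, subvec] using sum_extendZero_mul T d x

theorem subvec_extendZero (d : EuclideanSpace ℝ T) : subvec T (extendZero T d) = d := by
  ext i
  simp [subvec, extendZero]

theorem norm_extendZero (d : EuclideanSpace ℝ T) : ‖extendZero T d‖ = ‖d‖ := by
  have := inner_extendZero T d (extendZero T d)
  rw [subvec_extendZero, real_inner_self_eq_norm_sq, real_inner_self_eq_norm_sq] at this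
  exact (sq_eq_sq₀ (norm_nonneg _) (norm_nonneg _)).1 this

theorem extendZero_subvec (x : EuclideanSpace ℝ (Fin m)) :
    extendZero T (subvec T x) = keepOn T x := by
  ext i
  by_cases h : i ∈ T <;> simp [subvec, extendZero, keepOn, h]

theorem norm_keepOn (x : EuclideanSpace ℝ (Fin m)) : ‖keepOn T x‖ = ‖subvec T x‖ := by
  rw [← extendZero_subvec, norm_extendZero]

theorem subvec_add (x y : EuclideanSpace ℝ (Fin m)) :
    subvec T (x + y) = subvec T x + subvec T y := rfl

theorem subvec_sub (x y : EuclideanSpace ℝ (Fin m)) :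
    subvec T (x - y) = subvec T x - subvec T y := rfl

theorem norm_subvec_le (x : EuclideanSpace ℝ (Fin m)) : ‖subvec T x‖ ≤ ‖x‖ := by
  refine le_of_sq_le_sq ?_ (norm_nonneg _)
  rw [EuclideanSpace.norm_sq_eq, EuclideanSpace.norm_sq_eq]
  calc ∑ i : T, ‖subvec T x i‖ ^ 2 = ∑ i ∈ T, ‖x i‖ ^ 2 :=
        Finset.sum_coe_sort T fun i => ‖x i‖ ^ 2
    _ ≤ _ := Finset.sum_le_univ_sum_of_nonneg fun i => by positivity

/-- A principal submatrix is restriction ∘ H ∘ extension by zero, and these two maps are adjoint;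
this reduces quadratic forms of `H_T` to those of `H`. -/
theorem toEuclideanLin_submat (H : Matrix (Fin m) (Fin m) ℝ) (d : EuclideanSpace ℝ T) :
    Matrix.toEuclideanLin (submat T H) d =
      subvec T (Matrix.toEuclideanLin H (extendZero T d)) := by
  ext i
  simpa [subvec, submat, Matrix.mulVec, dotProduct] using
    (sum_extendZero_mul T d fun j => H i j).symm

end Restriction

/-! ### Gradient, descent inequality and Lipschitz bound for h. -/

section DualSmooth

variable {m n : ℕ} {f : EuclideanSpace ℝ (Fin n) → ℝ} {σ : ℝ}

/-- The bounds for `f*` pulled back along z ↦ -Aᵀz; the linear term ⟪z, b⟫ contributes nothing to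
the remainder. The gradient is written explicitly because its existence is deduced from this
estimate. -/
theorem dualSmooth_quadratic_bounds (hσ : 0 < σ) (hf : StrongConvexOn univ σ f)
    (A : Matrix (Fin m) (Fin n) ℝ) (b z z' : EuclideanSpace ℝ (Fin m)) :
    0 ≤ dualSmooth f A b z' - dualSmooth f A b z -
        inner ℝ (-(Matrix.toEuclideanLin A
          (gradConj f (-(Matrix.toEuclideanLin A.transpose z)))) - b) (z' - z) ∧
      dualSmooth f A b z' - dualSmooth f A b z -
        inner ℝ (-(Matrix.toEuclideanLin A
          (gradConj f (-(Matrix.toEuclideanLin A.transpose z)))) - b) (z' - z) ≤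
        lipConst A σ / 2 * ‖z' - z‖ ^ 2 := by
  set y := -(Matrix.toEuclideanLin A.transpose z) with hy
  set y' := -(Matrix.toEuclideanLin A.transpose z') with hy'
  have hyy : y' - y = -(Matrix.toEuclideanLin A.transpose (z' - z)) := by
    rw [map_sub, hy, hy']
    abel
  have e : dualSmooth f A b z' - dualSmooth f A b z -
      inner ℝ (-(Matrix.toEuclideanLin A (gradConj f y)) - b) (z' - z) =
      fenchelConj f y' - fenchelConj f y - inner ℝ (gradConj f y) (y' - y) := by
    rw [hyy, inner_neg_right, real_inner_comm _ (gradConj f y), inner_toEuclideanLin_transpose,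
      real_inner_comm (z' - z), inner_sub_right, inner_neg_right]
    simp only [dualSmooth, inner_sub_left, ← hy, ← hy']
    ring
  rw [e]
  constructor
  · have := (conj_quadratic_bounds_of_maximizer hσ hf (gradConj_spec hσ hf y).1
      (gradConj_spec hσ hf y).2 y').1
    linarith
  · have h1 := fenchelConj_le hσ hf y y'
    have h2 : 1 / (2 * σ) * ‖y' - y‖ ^ 2 ≤ lipConst A σ / 2 * ‖z' - z‖ ^ 2 := by
      rw [hyy, norm_neg]
      calc _ ≤ 1 / (2 * σ) * ((∑ i, ∑ j, A i j ^ 2) * ‖z' - z‖ ^ 2) := by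
            gcongr
            exact norm_toEuclideanLin_transpose_sq_le A _
        _ = _ := by
            rw [lipConst]
            field_simp
    linarith

theorem lipConst_nonneg (hσ : 0 < σ) (A : Matrix (Fin m) (Fin n) ℝ) : 0 ≤ lipConst A σ := by
  unfold lipConst
  positivity

theorem hasGradientAt_dualSmooth (hσ : 0 < σ) (hf : StrongConvexOn univ σ f)
    (A : Matrix (Fin m) (Fin n) ℝ) (b z : EuclideanSpace ℝ (Fin m)) :
    HasGradientAt (dualSmooth f A b) (-(Matrix.toEuclideanLin A
      (gradConj f (-(Matrix.toEuclideanLin A.transpose z)))) - b) z :=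
  hasGradientAt_of_quadratic_bound fun z' => by
    obtain ⟨h1, h2⟩ := dualSmooth_quadratic_bounds hσ hf A b z z'
    rwa [abs_of_nonneg h1]

theorem gradient_dualSmooth (hσ : 0 < σ) (hf : StrongConvexOn univ σ f)
    (A : Matrix (Fin m) (Fin n) ℝ) (b z : EuclideanSpace ℝ (Fin m)) :
    gradient (dualSmooth f A b) z = -(Matrix.toEuclideanLin A
      (gradConj f (-(Matrix.toEuclideanLin A.transpose z)))) - b :=
  (hasGradientAt_dualSmooth hσ hf A b z).gradient

theorem dualSmooth_le (hσ : 0 < σ) (hf : StrongConvexOn univ σ f)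
    (A : Matrix (Fin m) (Fin n) ℝ) (b z z' : EuclideanSpace ℝ (Fin m)) :
    dualSmooth f A b z' ≤ dualSmooth f A b z +
      inner ℝ (gradient (dualSmooth f A b) z) (z' - z) + lipConst A σ / 2 * ‖z' - z‖ ^ 2 := by
  have := (dualSmooth_quadratic_bounds hσ hf A b z z').2
  rw [gradient_dualSmooth hσ hf]
  linarith

theorem norm_gradient_dualSmooth_sub_le (hσ : 0 < σ) (hf : StrongConvexOn univ σ f)
    (A : Matrix (Fin m) (Fin n) ℝ) (b z z' : EuclideanSpace ℝ (Fin m)) :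
    ‖gradient (dualSmooth f A b) z - gradient (dualSmooth f A b) z'‖ ≤
      lipConst A σ * ‖z - z'‖ := by
  rw [gradient_dualSmooth hσ hf, gradient_dualSmooth hσ hf, sub_sub_sub_cancel_right,
    neg_sub_neg, ← map_sub, norm_sub_rev z]
  refine le_of_sq_le_sq ?_ (mul_nonneg (lipConst_nonneg hσ A) (norm_nonneg _))
  have hF : 0 ≤ ∑ i, ∑ j, A i j ^ 2 := by positivity
  refine (norm_toEuclideanLin_sq_le _ _).trans ?_
  have h1 := norm_gradConj_sub_le hσ hf (-(Matrix.toEuclideanLin A.transpose z'))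
    (-(Matrix.toEuclideanLin A.transpose z))
  rw [neg_sub_neg, ← map_sub] at h1
  calc _ ≤ (∑ i, ∑ j, A i j ^ 2) *
        (1 / σ * ‖Matrix.toEuclideanLin A.transpose (z - z')‖) ^ 2 := by gcongr
    _ ≤ (∑ i, ∑ j, A i j ^ 2) * ((1 / σ) ^ 2 * ((∑ i, ∑ j, A i j ^ 2) * ‖z - z'‖ ^ 2)) := by
        rw [mul_pow]
        gcongr
        exact norm_toEuclideanLin_transpose_sq_le A _
    _ = _ := by
        rw [lipConst, norm_sub_rev z]
        ring

theorem continuous_gradient_dualSmooth (hσ : 0 < σ) (hf : StrongConvexOn univ σ f)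
    (A : Matrix (Fin m) (Fin n) ℝ) (b : EuclideanSpace ℝ (Fin m)) :
    Continuous (gradient (dualSmooth f A b)) :=
  (LipschitzWith.of_dist_le_mul (K := (lipConst A σ).toNNReal) fun y y' => by
    rw [dist_eq_norm, dist_eq_norm, Real.coe_toNNReal _ (lipConst_nonneg hσ A)]
    exact norm_gradient_dualSmooth_sub_le hσ hf A b y y').continuous

theorem continuous_dualSmooth (hσ : 0 < σ) (hf : StrongConvexOn univ σ f)
    (A : Matrix (Fin m) (Fin n) ℝ) (b : EuclideanSpace ℝ (Fin m)) :
    Continuous (dualSmooth f A b) :=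
  continuous_iff_continuousAt.2 fun z => (hasGradientAt_dualSmooth hσ hf A b z).continuousAt

end DualSmooth

/-! ### Clarke Jacobians of Lipschitz maps and their quadratic forms. -/

section Jacobian

variable {p q : ℕ} {Φ : EuclideanSpace ℝ (Fin p) → EuclideanSpace ℝ (Fin q)}

theorem toEuclideanLin_jacobianMatrix (x d : EuclideanSpace ℝ (Fin p)) :
    Matrix.toEuclideanLin (jacobianMatrix Φ x) d = fderiv ℝ Φ x d := by
  have h : Matrix.toEuclideanLin (jacobianMatrix Φ x) = (fderiv ℝ Φ x).toLinearMap := by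
    refine (EuclideanSpace.basisFun (Fin p) ℝ).toBasis.ext fun j => ?_
    ext i
    simp [jacobianMatrix]
  exact congrArg (fun L => L d) h

/-- All entries lie in [-K, K], a compact box. This holds also where `Φ` is not differentiable,
since `fderiv` is then 0. -/
theorem exists_subseq_tendsto_jacobianMatrix {K : NNReal} (hΦ : LipschitzWith K Φ)
    (u : ℕ → EuclideanSpace ℝ (Fin p)) :
    ∃ V, ∃ φ : ℕ → ℕ, StrictMono φ ∧
      Tendsto (fun k => jacobianMatrix Φ (u (φ k))) atTop (𝓝 V) := by
  have hmem : ∀ k, (jacobianMatrix Φ (u k) : Fin q → Fin p → ℝ) ∈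
      Set.pi univ fun _ : Fin q => Set.pi univ fun _ : Fin p => Icc (-(K : ℝ)) K := by
    intro k i _ j _
    rw [mem_Icc, ← abs_le]
    calc |fderiv ℝ Φ (u k) (EuclideanSpace.single j 1) i|
        ≤ ‖fderiv ℝ Φ (u k) (EuclideanSpace.single j 1)‖ := by
          rw [← Real.norm_eq_abs]
          exact PiLp.norm_apply_le _ i
      _ ≤ ‖fderiv ℝ Φ (u k)‖ * ‖EuclideanSpace.single j (1 : ℝ)‖ :=
        ContinuousLinearMap.le_opNorm _ _
      _ ≤ K := by
        rw [PiLp.norm_single, norm_one, mul_one]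
        exact norm_fderiv_le_of_lipschitz ℝ hΦ
  obtain ⟨V, -, φ, hφ, hV⟩ := (isCompact_univ_pi fun _ : Fin q =>
    isCompact_univ_pi fun _ : Fin p => isCompact_Icc).tendsto_subseq hmem
  exact ⟨V, φ, hφ, hV⟩

/-- By Rademacher's theorem differentiability points are dense; Jacobians along a sequence of them
subconverge. -/
theorem clarkeJacobian_nonempty {K : NNReal} (hΦ : LipschitzWith K Φ)
    (x : EuclideanSpace ℝ (Fin p)) : (clarkeJacobian Φ x).Nonempty := by
  have hd : Dense {y | DifferentiableAt ℝ Φ y} :=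
    MeasureTheory.Measure.dense_of_ae (μ := MeasureTheory.volume) hΦ.ae_differentiableAt
  obtain ⟨u, hu, hux⟩ := mem_closure_iff_seq_limit.1 (hd x)
  obtain ⟨V, φ, hφ, hV⟩ := exists_subseq_tendsto_jacobianMatrix hΦ u
  exact ⟨V, subset_convexHull ℝ _
    ⟨u ∘ φ, fun k => hu _, hux.comp hφ.tendsto_atTop, hV⟩⟩

/-- A closed convex condition that holds for the Jacobians at all nearby points of differentiability
holds on the Clarke Jacobian. -/
theorem clarkeJacobian_subset {C : Set (Matrix (Fin q) (Fin p) ℝ)} (hconv : Convex ℝ C)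
    (hclosed : IsClosed C) {x : EuclideanSpace ℝ (Fin p)}
    (h : ∀ᶠ y in 𝓝 x, DifferentiableAt ℝ Φ y → jacobianMatrix Φ y ∈ C) :
    clarkeJacobian Φ x ⊆ C := by
  refine convexHull_min ?_ hconv
  rintro V ⟨u, hu, hux, hV⟩
  exact hclosed.mem_of_tendsto hV ((hux.eventually h).mono fun k hk => hk (hu k))

/-- The quadratic form of a matrix at a fixed vector, as a linear function of the matrix. -/
noncomputable def quadForm (x : EuclideanSpace ℝ (Fin p)) : Matrix (Fin p) (Fin p) ℝ →ₗ[ℝ] ℝ :=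
  (innerₗ _ x).comp ((LinearMap.applyₗ x).comp
    (Matrix.toEuclideanLin (𝕜 := ℝ) (m := Fin p) (n := Fin p)).toLinearMap)

theorem quadForm_apply (x : EuclideanSpace ℝ (Fin p)) (M : Matrix (Fin p) (Fin p) ℝ) :
    quadForm x M = inner ℝ x (Matrix.toEuclideanLin M x) := rfl

theorem quadForm_jacobianMatrix_le {K : NNReal}
    {Φ : EuclideanSpace ℝ (Fin p) → EuclideanSpace ℝ (Fin p)} (hΦ : LipschitzWith K Φ)
    (x y : EuclideanSpace ℝ (Fin p)) : quadForm x (jacobianMatrix Φ y) ≤ K * ‖x‖ ^ 2 := by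
  rw [quadForm_apply, toEuclideanLin_jacobianMatrix]
  calc _ ≤ ‖x‖ * ‖fderiv ℝ Φ y x‖ := real_inner_le_norm _ _
    _ ≤ ‖x‖ * (K * ‖x‖) := by
        gcongr
        exact (ContinuousLinearMap.le_opNorm _ _).trans
          (by gcongr; exact norm_fderiv_le_of_lipschitz ℝ hΦ)
    _ = _ := by ring

theorem quadForm_clarkeJacobian_le {K : NNReal}
    {Φ : EuclideanSpace ℝ (Fin p) → EuclideanSpace ℝ (Fin p)} (hΦ : LipschitzWith K Φ)
    {y : EuclideanSpace ℝ (Fin p)} {Q : Matrix (Fin p) (Fin p) ℝ} (hQ : Q ∈ clarkeJacobian Φ y)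
    (x : EuclideanSpace ℝ (Fin p)) : quadForm x Q ≤ K * ‖x‖ ^ 2 :=
  clarkeJacobian_subset (C := {Q | quadForm x Q ≤ K * ‖x‖ ^ 2})
    (convex_halfSpace_le (quadForm x).isLinear _)
    (isClosed_le (quadForm x).continuous_of_finiteDimensional continuous_const)
    (Eventually.of_forall fun _ _ => quadForm_jacobianMatrix_le hΦ x _) hQ

theorem tendsto_quadForm {V : ℕ → Matrix (Fin p) (Fin p) ℝ} {V₀ : Matrix (Fin p) (Fin p) ℝ}
    {x : ℕ → EuclideanSpace ℝ (Fin p)} {x₀ : EuclideanSpace ℝ (Fin p)}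
    (hV : Tendsto V atTop (𝓝 V₀)) (hx : Tendsto x atTop (𝓝 x₀)) :
    Tendsto (fun k => quadForm (x k) (V k)) atTop (𝓝 (quadForm x₀ V₀)) := by
  have hx' : ∀ i, Tendsto (fun k => x k i) atTop (𝓝 (x₀ i)) := fun i =>
    ((PiLp.continuous_apply 2 _ i).tendsto x₀).comp hx
  have hV' : ∀ i j, Tendsto (fun k => V k i j) atTop (𝓝 (V₀ i j)) := fun i j =>
    tendsto_pi_nhds.1 (tendsto_pi_nhds.1 hV i) j
  have e : ∀ (y : EuclideanSpace ℝ (Fin p)) (M : Matrix (Fin p) (Fin p) ℝ),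
      quadForm y M = ∑ i, (∑ j, M i j * y j) * y i := fun y M => by
    simp [quadForm_apply, PiLp.inner_apply, Matrix.mulVec, dotProduct]
  simp only [e]
  exact tendsto_finsetSum _ fun i _ =>
    (tendsto_finsetSum _ fun j _ => (hV' i j).mul (hx' j)).mul (hx' i)

/-- If the quadratic forms of the Clarke Jacobian at a point are positive on a compact set, then
they are uniformly positive on it for all nearby points. -/
theorem exists_uniform_quadForm_pos {K : NNReal}
    {Φ : EuclideanSpace ℝ (Fin p) → EuclideanSpace ℝ (Fin p)} (hΦ : LipschitzWith K Φ)
    {y : EuclideanSpace ℝ (Fin p)} {X : Set (EuclideanSpace ℝ (Fin p))} (hX : IsCompact X)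
    (hpos : ∀ Q ∈ clarkeJacobian Φ y, ∀ x ∈ X, 0 < quadForm x Q) :
    ∃ ε η : ℝ, 0 < ε ∧ 0 < η ∧ ∀ y' ∈ Metric.ball y ε, ∀ Q ∈ clarkeJacobian Φ y', ∀ x ∈ X,
      η ≤ quadForm x Q := by
  -- The lower bound is a closed convex condition on the matrix, so it suffices to check Jacobians
  -- at differentiability points. A single δ serves as radius and as bound, so that negating gives
  -- one sequence.
  suffices h : ∃ δ : ℝ, 0 < δ ∧ ∀ y' ∈ Metric.ball y δ, DifferentiableAt ℝ Φ y' → ∀ x ∈ X,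
      δ ≤ quadForm x (jacobianMatrix Φ y') by
    obtain ⟨δ, hδ, h⟩ := h
    refine ⟨δ, δ, hδ, hδ, fun y' hy' Q hQ x hx => ?_⟩
    exact clarkeJacobian_subset (C := {Q | δ ≤ quadForm x Q})
      (convex_halfSpace_ge (quadForm x).isLinear _)
      (isClosed_le continuous_const (quadForm x).continuous_of_finiteDimensional)
      (by filter_upwards [Metric.isOpen_ball.mem_nhds hy'] with w hw hd using h w hw hd x hx) hQ
  by_contra! hcon
  choose u hu hdiff x hx hlt using fun k : ℕ => hcon (1 / ((k : ℝ) + 1)) (by positivity)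
  obtain ⟨x₀, hx₀, φ, hφ, hxφ⟩ := hX.tendsto_subseq hx
  obtain ⟨V, ψ, hψ, hV⟩ := exists_subseq_tendsto_jacobianMatrix hΦ (u ∘ φ)
  have hlim : Tendsto (fun k : ℕ => 1 / ((k : ℝ) + 1)) atTop (𝓝 0) :=
    tendsto_one_div_add_atTop_nhds_zero_nat
  have hut : Tendsto u atTop (𝓝 y) := by
    rw [tendsto_iff_dist_tendsto_zero]
    exact squeeze_zero (fun _ => dist_nonneg) (fun k => (hu k).le) hlim
  -- The limit matrix is itself one of the generators of the Clarke Jacobian at y, so positivity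
  -- there applies to it.
  have hVmem : V ∈ clarkeJacobian Φ y := subset_convexHull ℝ _
    ⟨(u ∘ φ) ∘ ψ, fun k => hdiff _, (hut.comp hφ.tendsto_atTop).comp hψ.tendsto_atTop, hV⟩
  have h1 : Tendsto (fun k => quadForm (x (φ (ψ k))) (jacobianMatrix Φ (u (φ (ψ k))))) atTop
      (𝓝 (quadForm x₀ V)) :=
    tendsto_quadForm hV (hxφ.comp hψ.tendsto_atTop)
  have h2 : quadForm x₀ V ≤ 0 :=
    le_of_tendsto_of_tendsto' h1 (hlim.comp (hφ.comp hψ).tendsto_atTop)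
      fun k => (hlt (φ (ψ k))).le
  exact (hpos V hVmem x₀ hx₀).not_ge h2

end Jacobian

/-! ### Generalized Hessians: symmetry and uniform eigenvalue bounds. -/

section GeneralizedHessian

variable {m n : ℕ} {f : EuclideanSpace ℝ (Fin n) → ℝ} {σ : ℝ}

/-- `f*` is differentiable everywhere, so its second derivative is symmetric at each point where the
gradient is differentiable. -/
theorem jacobianMatrix_gradConj_transpose (hσ : 0 < σ) (hf : StrongConvexOn univ σ f)
    {y : EuclideanSpace ℝ (Fin n)} (hy : DifferentiableAt ℝ (gradConj f) y) :
    (jacobianMatrix (gradConj f) y).transpose = jacobianMatrix (gradConj f) y := by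
  have h1 : ∀ x, HasFDerivAt (fenchelConj f) (innerSL ℝ (gradConj f x)) x := fun x =>
    (hasGradientAt_fenchelConj hσ hf x).hasFDerivAt
  have h2 : HasFDerivAt (fun x => innerSL ℝ (gradConj f x))
      ((innerSL ℝ).comp (fderiv ℝ (gradConj f) y)) y :=
    (innerSL ℝ (E := EuclideanSpace ℝ (Fin n))).hasFDerivAt.comp y hy.hasFDerivAt
  have h3 := second_derivative_symmetric h1 h2
  ext i j
  have := h3 (EuclideanSpace.single i 1) (EuclideanSpace.single j 1)
  simpa [jacobianMatrix, EuclideanSpace.inner_single_right] using this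

theorem transpose_of_mem_clarkeJacobian_gradConj (hσ : 0 < σ) (hf : StrongConvexOn univ σ f)
    {y : EuclideanSpace ℝ (Fin n)} {Q : Matrix (Fin n) (Fin n) ℝ}
    (hQ : Q ∈ clarkeJacobian (gradConj f) y) : Q.transpose = Q := by
  refine clarkeJacobian_subset (C := {Q | Q.transpose = Q}) ?_
    (isClosed_eq continuous_id.matrix_transpose continuous_id)
    (Eventually.of_forall fun y' hy' => jacobianMatrix_gradConj_transpose hσ hf hy') hQ
  intro M hM N hN a b _ _ _
  simp only [mem_ofPred_eq] at *
  rw [Matrix.transpose_add, Matrix.transpose_smul, Matrix.transpose_smul, hM, hN]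

theorem isHermitian_submat_of_mem_genHessian (hσ : 0 < σ) (hf : StrongConvexOn univ σ f)
    {A : Matrix (Fin m) (Fin n) ℝ} {z : EuclideanSpace ℝ (Fin m)}
    {H : Matrix (Fin m) (Fin m) ℝ} (hH : H ∈ genHessian f A z) (T : Finset (Fin m)) :
    (submat T H).IsHermitian := by
  obtain ⟨Q, hQ, rfl⟩ := hH
  refine Matrix.IsHermitian.submatrix ?_ _
  rw [Matrix.IsHermitian, Matrix.conjTranspose_eq_transpose_of_trivial, Matrix.transpose_mul,
    Matrix.transpose_mul, Matrix.transpose_transpose,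
    transpose_of_mem_clarkeJacobian_gradConj hσ hf hQ, Matrix.mul_assoc]

theorem genHessian_nonempty (hσ : 0 < σ) (hf : StrongConvexOn univ σ f)
    (A : Matrix (Fin m) (Fin n) ℝ) (z : EuclideanSpace ℝ (Fin m)) : (genHessian f A z).Nonempty :=
  have ⟨Q, hQ⟩ := clarkeJacobian_nonempty (lipschitzWith_gradConj hσ hf)
    (-(Matrix.toEuclideanLin A.transpose z))
  ⟨_, Q, hQ, rfl⟩

theorem inner_submat_eq_quadForm (A : Matrix (Fin m) (Fin n) ℝ) (Q : Matrix (Fin n) (Fin n) ℝ)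
    (T : Finset (Fin m)) (d : EuclideanSpace ℝ T) :
    inner ℝ d (Matrix.toEuclideanLin (submat T (A * Q * A.transpose)) d) =
      quadForm (Matrix.toEuclideanLin A.transpose (extendZero T d)) Q := by
  rw [toEuclideanLin_submat, ← inner_extendZero, toEuclideanLin_mul_apply,
    toEuclideanLin_mul_apply, ← inner_toEuclideanLin_transpose, quadForm_apply]

/-- A real eigenvalue is the value of the quadratic form at a unit eigenvector, so bounds on the
form pass to the spectrum. -/
theorem exists_unit_eigenvector {ι : Type*} [Fintype ι] [DecidableEq ι] {M : Matrix ι ι ℝ} {l : ℝ}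
    (hl : l ∈ spectrum ℝ M) :
    ∃ d : EuclideanSpace ℝ ι, ‖d‖ = 1 ∧ inner ℝ d (Matrix.toEuclideanLin M d) = l := by
  rw [← Matrix.spectrum_toLpLin 2, ← Module.End.hasEigenvalue_iff_mem_spectrum] at hl
  obtain ⟨v, hv⟩ := hl.exists_hasEigenvector
  have hv0 : ‖v‖ ≠ 0 := norm_ne_zero_iff.2 hv.2
  refine ⟨‖v‖⁻¹ • v, by rw [norm_smul, norm_inv, norm_norm, inv_mul_cancel₀ hv0], ?_⟩
  rw [map_smul, hv.apply_eq_smul, inner_smul_left, inner_smul_right, inner_smul_right,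
    real_inner_self_eq_norm_sq]
  simp
  field_simp

/-- The eigenvalues of the restricted generalized Hessians are locally bounded, and bounded away
from zero, around a point satisfying the second-order condition. -/
theorem exists_eigenvalueBounds (hσ : 0 < σ) (hf : StrongConvexOn univ σ f)
    {A : Matrix (Fin m) (Fin n) ℝ} {zs : EuclideanSpace ℝ (Fin m)} (hs : SOSC f A zs) :
    ∃ ε η₃ η₄ : ℝ, EigenvalueBounds f A zs ε η₃ η₄ := by
  set S := supp zs
  have hlip := lipschitzWith_gradConj hσ hf
  have hcontA : Continuous (Matrix.toEuclideanLin A.transpose) :=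
    LinearMap.continuous_of_finiteDimensional _
  have hcont : Continuous fun d : EuclideanSpace ℝ S =>
      Matrix.toEuclideanLin A.transpose (extendZero S d) := by
    refine hcontA.comp ((PiLp.continuous_toLp 2 _).comp (continuous_pi fun i => ?_))
    split_ifs
    · fun_prop
    · exact continuous_const
  have hX := (isCompact_sphere (0 : EuclideanSpace ℝ S) 1).image hcont
  have hpos : ∀ Q ∈ clarkeJacobian (gradConj f) (-(Matrix.toEuclideanLin A.transpose zs)),
      ∀ x ∈ (fun d : EuclideanSpace ℝ S => Matrix.toEuclideanLin A.transpose (extendZero S d)) ''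
        Metric.sphere 0 1, 0 < quadForm x Q := by
    rintro Q hQ _ ⟨d, hd, rfl⟩
    have hd0 : d.ofLp ≠ 0 := by
      intro h0
      have : d = 0 := by
        ext i
        exact congrFun h0 i
      simp [this] at hd
    have := hs _ ⟨Q, hQ, rfl⟩ d.ofLp hd0
    rw [← inner_submat_eq_quadForm]
    simpa [PiLp.inner_apply, dotProduct, mul_comm] using this
  obtain ⟨ε, η, hε, hη, h⟩ := exists_uniform_quadForm_pos hlip hX hpos
  obtain ⟨δ, hδ, hball⟩ := Metric.continuous_iff.1 hcontA.neg zs ε hε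
  -- Every eigenvalue is at most ℓ_h; the extra 1 keeps η₄ positive when ℓ_h = 0.
  refine ⟨δ, η, lipConst A σ + 1, hδ, hη, by linarith [lipConst_nonneg hσ A], ?_⟩
  rintro z hz _ ⟨Q, hQ, rfl⟩ l hl
  obtain ⟨d, hd, rfl⟩ := exists_unit_eigenvector hl
  rw [inner_submat_eq_quadForm]
  refine ⟨h _ (hball z hz) Q hQ _ ⟨d, by simpa using hd, rfl⟩, ?_⟩
  calc _ ≤ ((1 / σ).toNNReal : ℝ) *
        ‖Matrix.toEuclideanLin A.transpose (extendZero S d)‖ ^ 2 :=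
        quadForm_clarkeJacobian_le hlip hQ _
    _ ≤ 1 / σ * ((∑ i, ∑ j, A i j ^ 2) * ‖extendZero S d‖ ^ 2) := by
        rw [Real.coe_toNNReal _ (by positivity)]
        gcongr
        exact norm_toEuclideanLin_transpose_sq_le A _
    _ = lipConst A σ := by
        rw [norm_extendZero, hd, lipConst]
        ring
    _ ≤ _ := by linarith

/-- For symmetric M, the shift M - ηI has nonnegative spectrum and is therefore positive
semidefinite. Symmetry is what turns bounds on the real spectrum back into bounds on the quadratic
form. -/
theorem le_inner_of_le_spectrum {ι : Type*} [Fintype ι] [DecidableEq ι] {M : Matrix ι ι ℝ}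
    (hM : M.IsHermitian) {η : ℝ} (h : ∀ l ∈ spectrum ℝ M, η ≤ l) (d : EuclideanSpace ℝ ι) :
    η * ‖d‖ ^ 2 ≤ inner ℝ d (Matrix.toEuclideanLin M d) := by
  have hsub : (M - algebraMap ℝ (Matrix ι ι ℝ) η).PosSemidef := by
    rw [Matrix.posSemidef_iff_isHermitian_and_spectrum_nonneg]
    refine ⟨hM.sub (Matrix.isHermitian_diagonal _), fun l hl => ?_⟩
    rw [← spectrum.sub_singleton_eq] at hl
    obtain ⟨l', hl', _, rfl, rfl⟩ := hl
    exact sub_nonneg.2 (h l' hl')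
  have h1 := hsub.dotProduct_mulVec_nonneg d.ofLp
  have h2 : Matrix.mulVec (algebraMap ℝ (Matrix ι ι ℝ) η) d.ofLp = η • d.ofLp := by
    rw [Algebra.algebraMap_eq_smul_one, Matrix.smul_mulVec, Matrix.one_mulVec]
  rw [Matrix.sub_mulVec, h2, dotProduct_sub, dotProduct_smul] at h1
  rw [EuclideanSpace.real_norm_sq_eq]
  simpa [PiLp.inner_apply, dotProduct, mul_comm, ← sub_nonneg, pow_two] using h1

theorem EigenvalueBounds.le_inner (hσ : 0 < σ) (hf : StrongConvexOn univ σ f)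
    {A : Matrix (Fin m) (Fin n) ℝ} {zs z : EuclideanSpace ℝ (Fin m)} {ε η₃ η₄ : ℝ}
    (h : EigenvalueBounds f A zs ε η₃ η₄) (hz : z ∈ Metric.ball zs ε)
    {H : Matrix (Fin m) (Fin m) ℝ} (hH : H ∈ genHessian f A z) (d : EuclideanSpace ℝ (supp zs)) :
    η₃ * ‖d‖ ^ 2 ≤ inner ℝ d (Matrix.toEuclideanLin (submat (supp zs) H) d) :=
  le_inner_of_le_spectrum (isHermitian_submat_of_mem_genHessian hσ hf hH _)
    (fun l hl => (h.2.2.2 z hz H hH l hl).1) d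

end GeneralizedHessian

/-! ### Global descent and support identification. -/

section Descent

variable {m n : ℕ} {f : EuclideanSpace ℝ (Fin n) → ℝ} {σ : ℝ}

/-- The dual objective without the barrier term, as a real number. -/
noncomputable def realObj (f : EuclideanSpace ℝ (Fin n) → ℝ) (A : Matrix (Fin m) (Fin n) ℝ)
    (b : EuclideanSpace ℝ (Fin m)) (μ : ℝ) (z : EuclideanSpace ℝ (Fin m)) : ℝ :=
  dualSmooth f A b z + μ * (supp z).card

theorem dualObj_of_nonneg (A : Matrix (Fin m) (Fin n) ℝ) (b : EuclideanSpace ℝ (Fin m)) (μ : ℝ)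
    {z : EuclideanSpace ℝ (Fin m)} (hz : ∀ i, 0 ≤ z i) :
    dualObj f A b μ z = (realObj f A b μ z : ℝ) := by
  rw [dualObj, sparseReg, nonnegBarrier, if_pos hz, add_zero, realObj, EReal.coe_add]

theorem dualObj_of_not_nonneg (A : Matrix (Fin m) (Fin n) ℝ) (b : EuclideanSpace ℝ (Fin m))
    (μ : ℝ) {z : EuclideanSpace ℝ (Fin m)} (hz : ¬ ∀ i, 0 ≤ z i) : dualObj f A b μ z = ⊤ := by
  rw [dualObj, sparseReg, nonnegBarrier, if_neg hz, EReal.coe_add_top, EReal.coe_add_top]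

/-- F(v) is finite, so the decrease test rules out F(w) = +∞. -/
theorem Accepted.nonneg {A : Matrix (Fin m) (Fin n) ℝ} {b : EuclideanSpace ℝ (Fin m)}
    {μ c₁ c₂ : ℝ} {T : Finset (Fin m)} {v w : EuclideanSpace ℝ (Fin m)} (hv : ∀ i, 0 ≤ v i)
    (h : Accepted f A b μ c₁ c₂ T v w) : ∀ i, 0 ≤ w i := by
  by_contra hw
  have h1 := h.1
  rw [dualObj_of_nonneg A b μ hv, dualObj_of_not_nonneg A b μ hw, EReal.top_add_coe,
    top_le_iff] at h1
  exact EReal.coe_ne_top _ h1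

theorem Accepted.realObj_le {A : Matrix (Fin m) (Fin n) ℝ} {b : EuclideanSpace ℝ (Fin m)}
    {μ c₁ c₂ : ℝ} {T : Finset (Fin m)} {v w : EuclideanSpace ℝ (Fin m)} (hv : ∀ i, 0 ≤ v i)
    (h : Accepted f A b μ c₁ c₂ T v w) :
    realObj f A b μ w + c₁ * ‖w - v‖ ^ 2 ≤ realObj f A b μ v := by
  have h1 := h.1
  rw [dualObj_of_nonneg A b μ hv, dualObj_of_nonneg A b μ (h.nonneg hv)] at h1
  exact_mod_cast h1

theorem mem_activeSet {A : Matrix (Fin m) (Fin n) ℝ} {b : EuclideanSpace ℝ (Fin m)} {μ τ : ℝ}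
    {z : EuclideanSpace ℝ (Fin m)} {i : Fin m} :
    i ∈ activeSet f A b μ τ z ↔ √(2 * τ * μ) < gradStep f A b τ z i := by
  simp [activeSet]

theorem proxStep_apply_of_mem {A : Matrix (Fin m) (Fin n) ℝ} {b : EuclideanSpace ℝ (Fin m)}
    {μ τ : ℝ} {z : EuclideanSpace ℝ (Fin m)} {i : Fin m} (hi : i ∈ activeSet f A b μ τ z) :
    proxStep f A b μ τ z i = gradStep f A b τ z i := by
  simp [proxStep, keepOn, hi]

theorem proxStep_apply_of_notMem {A : Matrix (Fin m) (Fin n) ℝ} {b : EuclideanSpace ℝ (Fin m)}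
    {μ τ : ℝ} {z : EuclideanSpace ℝ (Fin m)} {i : Fin m} (hi : i ∉ activeSet f A b μ τ z) :
    proxStep f A b μ τ z i = 0 := by
  simp [proxStep, keepOn, hi]

theorem proxStep_nonneg {A : Matrix (Fin m) (Fin n) ℝ} {b : EuclideanSpace ℝ (Fin m)} {μ τ : ℝ}
    {z : EuclideanSpace ℝ (Fin m)} (i : Fin m) : 0 ≤ proxStep f A b μ τ z i := by
  by_cases hi : i ∈ activeSet f A b μ τ z
  · rw [proxStep_apply_of_mem hi]
    exact (Real.sqrt_nonneg _).trans (mem_activeSet.1 hi).le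
  · rw [proxStep_apply_of_notMem hi]

theorem card_supp_eq_sum (z : EuclideanSpace ℝ (Fin m)) :
    ((supp z).card : ℝ) = ∑ i, if z i = 0 then (0 : ℝ) else 1 := by
  rw [supp, Finset.card_filter]
  push_cast
  exact Finset.sum_congr rfl fun i _ => by split_ifs <;> simp_all

/-- Hard thresholding minimizes the scalar proximal objective over the nonnegative reals. -/
theorem hardThreshold_le {κ y x : ℝ} (hκ : 0 ≤ κ) (hx : 0 ≤ x) :
    ((if √(2 * κ) < y then y else 0) - y) ^ 2 +
        2 * κ * (if (if √(2 * κ) < y then y else 0) = 0 then 0 else 1) ≤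
      (x - y) ^ 2 + 2 * κ * (if x = 0 then 0 else 1) := by
  have hs := Real.sq_sqrt (show (0 : ℝ) ≤ 2 * κ by positivity)
  have hs0 := Real.sqrt_nonneg (2 * κ)
  set s := √(2 * κ)
  rcases lt_or_ge s y with hy | hy
  · have hy0 : y ≠ 0 := (hs0.trans_lt hy).ne'
    rw [if_pos hy, if_neg hy0]
    split_ifs with h0
    · subst h0
      nlinarith
    · nlinarith [sq_nonneg (x - y)]
  · rw [if_neg hy.not_gt, if_pos rfl]
    split_ifs with h0
    · subst h0
      linarith
    -- With s² = 2κ, x ≥ 0 and y ≤ s: (x - y)² + s² - y² = x² - 2xy + s² ≥ (x - s)².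
    · nlinarith [sq_nonneg (x - s), mul_nonneg hx (sub_nonneg.2 hy)]

/-- Each coordinate of v minimizes the proximal model over the nonnegative reals, so v beats z
there. The model exceeds the descent inequality for `h` by (1/(2τ) - ℓ_h/2)‖v - z‖². -/
theorem realObj_proxStep_le (hσ : 0 < σ) (hf : StrongConvexOn univ σ f)
    (A : Matrix (Fin m) (Fin n) ℝ) (b : EuclideanSpace ℝ (Fin m)) {μ τ : ℝ} (hμ : 0 < μ)
    (hτ : 0 < τ) {z : EuclideanSpace ℝ (Fin m)} (hz : ∀ i, 0 ≤ z i) :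
    realObj f A b μ (proxStep f A b μ τ z) +
      (1 / (2 * τ) - lipConst A σ / 2) * ‖proxStep f A b μ τ z - z‖ ^ 2 ≤ realObj f A b μ z := by
  set v := proxStep f A b μ τ z with hv
  set g := gradient (dualSmooth f A b) z with hg
  have h1 := dualSmooth_le hσ hf A b z v
  have hcoord : ∀ i, (v i - z i) ^ 2 + 2 * τ * (g i * (v i - z i)) +
      2 * τ * μ * (if v i = 0 then 0 else 1) ≤ 2 * τ * μ * (if z i = 0 then 0 else 1) := by
    intro i
    have h2 := hardThreshold_le (κ := τ * μ) (y := gradStep f A b τ z i) (by positivity) (hz i)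
    have h3 : v i = if √(2 * (τ * μ)) < gradStep f A b τ z i then gradStep f A b τ z i else 0 := by
      rw [← mul_assoc]
      split_ifs with h
      · exact proxStep_apply_of_mem (mem_activeSet.2 h)
      · exact proxStep_apply_of_notMem fun h' => h (mem_activeSet.1 h')
    have h4 : gradStep f A b τ z i = z i - τ * g i := rfl
    rw [← h3, h4] at h2
    linarith
  have hsum := Finset.sum_le_sum fun i (_ : i ∈ Finset.univ) => hcoord i
  simp only [Finset.sum_add_distrib, ← Finset.mul_sum] at hsum
  rw [← card_supp_eq_sum, ← card_supp_eq_sum] at hsum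
  have h5 : ∑ i, (v i - z i) ^ 2 = ‖v - z‖ ^ 2 := by
    simp [EuclideanSpace.real_norm_sq_eq]
  have h6 : ∑ i, g i * (v i - z i) = inner ℝ g (v - z) := by
    simp [PiLp.inner_apply, mul_comm]
  rw [h5, h6] at hsum
  have h7 : 1 / (2 * τ) * ‖v - z‖ ^ 2 + inner ℝ g (v - z) + μ * (supp v).card ≤
      μ * (supp z).card := by
    have h8 := mul_le_mul_of_nonneg_left hsum (show 0 ≤ 1 / (2 * τ) by positivity)
    calc _ = 1 / (2 * τ) * (‖v - z‖ ^ 2 + 2 * τ * inner ℝ g (v - z) +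
          2 * τ * μ * (supp v).card) := by
          field_simp
      _ ≤ _ := h8
      _ = _ := by field_simp
  simp only [realObj]
  linarith

variable {A : Matrix (Fin m) (Fin n) ℝ} {b : EuclideanSpace ℝ (Fin m)} {μ τ c₁ c₂ γ : ℝ}

theorem Step.nonneg {z z' : EuclideanSpace ℝ (Fin m)} (h : Step f A b μ τ c₁ c₂ γ z z')
    (i : Fin m) : 0 ≤ z' i := by
  obtain ⟨H, -, d, -, h1, h2⟩ := h
  by_cases hacc : Accepted f A b μ c₁ c₂ (activeSet f A b μ τ z) (proxStep f A b μ τ z)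
    (newtonStep (activeSet f A b μ τ z) (proxStep f A b μ τ z) d)
  · rw [h1 hacc]
    exact hacc.nonneg proxStep_nonneg i
  · rw [h2 hacc]
    exact proxStep_nonneg i

theorem Step.realObj_le (hc₁ : 0 < c₁) {z z' : EuclideanSpace ℝ (Fin m)}
    (h : Step f A b μ τ c₁ c₂ γ z z') :
    realObj f A b μ z' ≤ realObj f A b μ (proxStep f A b μ τ z) := by
  obtain ⟨H, -, d, -, h1, h2⟩ := h
  by_cases hacc : Accepted f A b μ c₁ c₂ (activeSet f A b μ τ z) (proxStep f A b μ τ z)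
    (newtonStep (activeSet f A b μ τ z) (proxStep f A b μ τ z) d)
  · rw [h1 hacc]
    have := hacc.realObj_le proxStep_nonneg
    have : 0 ≤ c₁ * ‖newtonStep (activeSet f A b μ τ z) (proxStep f A b μ τ z) d -
      proxStep f A b μ τ z‖ ^ 2 := by positivity
    linarith
  · rw [h2 hacc]

/-- A sequence that decreases by at least the terms of a nonnegative sequence and is bounded below
forces these terms to tend to zero. -/
theorem tendsto_zero_of_descent {a r : ℕ → ℝ} (hr : ∀ k, 0 ≤ r k)
    (h : ∀ k, a (k + 1) + r k ≤ a k) (hbdd : BddBelow (range a)) : Tendsto r atTop (𝓝 0) := by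
  have hanti : Antitone a := antitone_nat_of_succ_le fun k => by linarith [hr k, h k]
  have hlim := tendsto_atTop_ciInf hanti hbdd
  have hdiff : Tendsto (fun k => a k - a (k + 1)) atTop (𝓝 0) := by
    simpa using hlim.sub (hlim.comp (tendsto_add_atTop_nat 1))
  exact squeeze_zero hr (fun k => by linarith [h k]) hdiff

theorem tendsto_proxStep_sub (hσ : 0 < σ) (hf : StrongConvexOn univ σ f) (hμ : 0 < μ)
    (hτ : 0 < τ) (hτ' : τ * lipConst A σ < 1) (hc₁ : 0 < c₁)
    {z : ℕ → EuclideanSpace ℝ (Fin m)} (hz : IsSequence f A b μ τ c₁ c₂ γ z)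
    (hbdd : Bornology.IsBounded (range z)) :
    Tendsto (fun k => proxStep f A b μ τ (z k) - z k) atTop (𝓝 0) := by
  have hκ : 0 < 1 / (2 * τ) - lipConst A σ / 2 := by
    rw [sub_pos, lt_div_iff₀ (by positivity)]
    linarith
  -- The index is shifted by one because z⁰ is arbitrary, while every later iterate is nonnegative.
  have hbelow : BddBelow (range fun k => realObj f A b μ (z (k + 1))) := by
    obtain ⟨C, hC⟩ := (hbdd.isCompact_closure.bddBelow_image
      (continuous_dualSmooth hσ hf A b).continuousOn)
    refine ⟨C, ?_⟩
    rintro _ ⟨k, rfl⟩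
    have h1 : C ≤ dualSmooth f A b (z (k + 1)) :=
      hC ⟨_, subset_closure (mem_range_self _), rfl⟩
    have h2 : 0 ≤ μ * (supp (z (k + 1))).card := by positivity
    simp only [realObj]
    linarith
  have h1 := tendsto_zero_of_descent (r := fun k => (1 / (2 * τ) - lipConst A σ / 2) *
      ‖proxStep f A b μ τ (z (k + 1)) - z (k + 1)‖ ^ 2) (fun k => by positivity)
    (fun k => by
      have h2 := realObj_proxStep_le hσ hf A b hμ hτ (hz k).nonneg
      have h3 := (hz (k + 1)).realObj_le hc₁
      linarith) hbelow
  have h4 : Tendsto (fun k => ‖proxStep f A b μ τ (z (k + 1)) - z (k + 1)‖ ^ 2) atTop (𝓝 0) := by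
    have := h1.const_mul (1 / (2 * τ) - lipConst A σ / 2)⁻¹
    simpa only [← mul_assoc, inv_mul_cancel₀ hκ.ne', one_mul, mul_zero] using this
  have h5 : Tendsto (fun k => ‖proxStep f A b μ τ (z (k + 1)) - z (k + 1)‖) atTop (𝓝 0) := by
    simpa using h4.sqrt
  exact (tendsto_add_atTop_iff_nat 1).1 (tendsto_zero_iff_norm_tendsto_zero.2 h5)

theorem mem_supp {z : EuclideanSpace ℝ (Fin m)} {i : Fin m} : i ∈ supp z ↔ z i ≠ 0 := by
  simp [supp]

/-- Along a convergent sequence whose proximal steps converge to the same point, the limit has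
nonzero entries bounded below by the threshold, and the gradient vanishes on its support. -/
theorem limit_of_proxStep (hσ : 0 < σ) (hf : StrongConvexOn univ σ f) (hτ : 0 < τ)
    {z : ℕ → EuclideanSpace ℝ (Fin m)} {zs : EuclideanSpace ℝ (Fin m)}
    (hz : Tendsto z atTop (𝓝 zs))
    (hv : Tendsto (fun k => proxStep f A b μ τ (z k)) atTop (𝓝 zs)) {i : Fin m}
    (hi : i ∈ supp zs) : √(2 * τ * μ) ≤ zs i ∧ gradient (dualSmooth f A b) zs i = 0 := by
  have happ : ∀ {u : ℕ → EuclideanSpace ℝ (Fin m)} {x : EuclideanSpace ℝ (Fin m)},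
      Tendsto u atTop (𝓝 x) → Tendsto (fun k => u k i) atTop (𝓝 (x i)) := fun {u x} h =>
    ((PiLp.continuous_apply 2 _ i).tendsto x).comp h
  have hmem : ∀ᶠ k in atTop, i ∈ activeSet f A b μ τ (z k) := by
    filter_upwards [(happ hv).eventually_ne (mem_supp.1 hi)] with k hk
    by_contra h
    exact hk (proxStep_apply_of_notMem h)
  have hstep : Tendsto (fun k => gradStep f A b τ (z k) i) atTop (𝓝 (zs i)) :=
    (happ hv).congr' (hmem.mono fun k hk => proxStep_apply_of_mem hk)
  refine ⟨ge_of_tendsto hstep (hmem.mono fun k hk => (mem_activeSet.1 hk).le), ?_⟩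
  have hcont : Continuous (gradStep f A b τ) :=
    continuous_id.sub ((continuous_gradient_dualSmooth hσ hf A b).const_smul τ)
  -- On the support the gradient steps tend both to zs_i and, by continuity, to zs_i - τ∇_i h(zs).
  have heq := tendsto_nhds_unique hstep (happ ((hcont.tendsto zs).comp hz))
  have h1 : gradStep f A b τ zs i = zs i - τ * gradient (dualSmooth f A b) zs i := rfl
  have h2 : τ * gradient (dualSmooth f A b) zs i = 0 := by linarith
  exact (mul_eq_zero.1 h2).resolve_left hτ.ne'

theorem abs_sub_apply_le (x y : EuclideanSpace ℝ (Fin m)) (i : Fin m) :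
    |x i - y i| ≤ ‖x - y‖ := by
  simpa using PiLp.norm_apply_le (x - y) i

/-- Gap argument: active entries of v exceed the threshold and inactive ones are 0, while entries of
zs are 0 or at least the threshold. A mismatch would cost a distance of at least the threshold. -/
theorem activeSet_eq_supp {z zs : EuclideanSpace ℝ (Fin m)}
    (hzs : ∀ i ∈ supp zs, √(2 * τ * μ) ≤ zs i)
    (hv : ‖proxStep f A b μ τ z - zs‖ < √(2 * τ * μ)) : activeSet f A b μ τ z = supp zs := by
  ext i
  have h1 := abs_lt.1 ((abs_sub_apply_le (proxStep f A b μ τ z) zs i).trans_lt hv)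
  constructor
  · intro hi
    rw [mem_supp]
    intro h0
    have h2 := mem_activeSet.1 hi
    rw [proxStep_apply_of_mem hi] at h1
    linarith
  · intro hi
    by_contra h
    have := hzs i hi
    rw [proxStep_apply_of_notMem h] at h1
    linarith

end Descent

/-! ### Local estimates: linearization, Newton error and quadratic growth. -/

section LocalConvergence

variable {m n : ℕ} {f : EuclideanSpace ℝ (Fin n) → ℝ} {σ : ℝ}
  {A : Matrix (Fin m) (Fin n) ℝ} {b : EuclideanSpace ℝ (Fin m)} {μ τ c₁ c₂ γ : ℝ}

theorem norm_toEuclideanLin_le (A : Matrix (Fin m) (Fin n) ℝ) (x : EuclideanSpace ℝ (Fin n)) :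
    ‖Matrix.toEuclideanLin A x‖ ≤ √(∑ i, ∑ j, A i j ^ 2) * ‖x‖ := by
  refine le_of_sq_le_sq ?_ (by positivity)
  rw [mul_pow, Real.sq_sqrt (by positivity)]
  exact norm_toEuclideanLin_sq_le A x

theorem norm_toEuclideanLin_transpose_le (A : Matrix (Fin m) (Fin n) ℝ)
    (z : EuclideanSpace ℝ (Fin m)) :
    ‖Matrix.toEuclideanLin A.transpose z‖ ≤ √(∑ i, ∑ j, A i j ^ 2) * ‖z‖ := by
  refine le_of_sq_le_sq ?_ (by positivity)
  rw [mul_pow, Real.sq_sqrt (by positivity)]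
  exact norm_toEuclideanLin_transpose_sq_le A z

theorem neg_transpose_add_shift (A : Matrix (Fin m) (Fin n) ℝ) (v zs : EuclideanSpace ℝ (Fin m)) :
    -(Matrix.toEuclideanLin A.transpose zs) + -(Matrix.toEuclideanLin A.transpose (v - zs)) =
      -(Matrix.toEuclideanLin A.transpose v) := by
  rw [← neg_add, ← map_add, add_sub_cancel]

/-- The linearization error of `∇h` is controlled by that of `∇f*`. -/
theorem norm_gradient_remainder_le (hσ : 0 < σ) (hf : StrongConvexOn univ σ f)
    (b v zs : EuclideanSpace ℝ (Fin m)) (Q : Matrix (Fin n) (Fin n) ℝ) :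
    ‖gradient (dualSmooth f A b) v - gradient (dualSmooth f A b) zs -
        Matrix.toEuclideanLin (A * Q * A.transpose) (v - zs)‖ ≤
      √(∑ i, ∑ j, A i j ^ 2) *
        ‖gradConj f (-(Matrix.toEuclideanLin A.transpose zs) +
            -(Matrix.toEuclideanLin A.transpose (v - zs))) -
          gradConj f (-(Matrix.toEuclideanLin A.transpose zs)) -
          Matrix.toEuclideanLin Q (-(Matrix.toEuclideanLin A.transpose (v - zs)))‖ := by
  refine le_trans (le_of_eq ?_) (norm_toEuclideanLin_le A _)
  rw [← norm_neg, neg_transpose_add_shift, gradient_dualSmooth hσ hf, gradient_dualSmooth hσ hf,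
    toEuclideanLin_mul_apply, toEuclideanLin_mul_apply]
  congr 1
  rw [map_sub (Matrix.toEuclideanLin A), map_sub (Matrix.toEuclideanLin A),
    map_neg (Matrix.toEuclideanLin Q), map_neg (Matrix.toEuclideanLin A)]
  abel

theorem mem_clarkeJacobian_shift {v zs : EuclideanSpace ℝ (Fin m)} {Q : Matrix (Fin n) (Fin n) ℝ}
    (hQ : Q ∈ clarkeJacobian (gradConj f) (-(Matrix.toEuclideanLin A.transpose v))) :
    Q ∈ clarkeJacobian (gradConj f) (-(Matrix.toEuclideanLin A.transpose zs) +
      -(Matrix.toEuclideanLin A.transpose (v - zs))) := by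
  rwa [neg_transpose_add_shift]

theorem norm_neg_transpose_lt {v zs : EuclideanSpace ℝ (Fin m)} {δ : ℝ}
    (hv : ‖v - zs‖ < δ / (√(∑ i, ∑ j, A i j ^ 2) + 1)) :
    ‖-(Matrix.toEuclideanLin A.transpose (v - zs))‖ < δ := by
  rw [lt_div_iff₀ (by positivity)] at hv
  rw [norm_neg]
  have := norm_toEuclideanLin_transpose_le A (v - zs)
  rcases (norm_nonneg (v - zs)).eq_or_lt with h | h
  · rw [← h] at hv this
    linarith
  · linarith

/-- `∇h` is `∇f*` composed with linear maps on both sides. Each costs a factor a = ‖A‖, whence the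
tolerance ε/(a² + 1); adding 1 covers A = 0. -/
theorem Semismooth.gradient_dualSmooth (hσ : 0 < σ) (hf : StrongConvexOn univ σ f)
    (hss : Semismooth (gradConj f)) (A : Matrix (Fin m) (Fin n) ℝ)
    (b zs : EuclideanSpace ℝ (Fin m)) {ε : ℝ} (hε : 0 < ε) :
    ∃ δ : ℝ, 0 < δ ∧ ∀ v, ‖v - zs‖ < δ → ∀ H ∈ genHessian f A v,
      ‖gradient (dualSmooth f A b) v - gradient (dualSmooth f A b) zs -
        Matrix.toEuclideanLin H (v - zs)‖ ≤ ε * ‖v - zs‖ := by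
  set a := √(∑ i, ∑ j, A i j ^ 2) with ha
  have ha0 : 0 ≤ a := Real.sqrt_nonneg _
  obtain ⟨δ, hδ, h⟩ := hss.2.2 (-(Matrix.toEuclideanLin A.transpose zs)) (ε / (a ^ 2 + 1))
    (by positivity)
  refine ⟨δ / (a + 1), by positivity, ?_⟩
  rintro v hv _ ⟨Q, hQ, rfl⟩
  have h1 := h _ (norm_neg_transpose_lt hv) Q (mem_clarkeJacobian_shift hQ)
  have h2 := norm_toEuclideanLin_transpose_le A (v - zs)
  rw [norm_neg] at h1
  refine (norm_gradient_remainder_le hσ hf b v zs Q).trans ?_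
  calc _ ≤ a * (ε / (a ^ 2 + 1) * (a * ‖v - zs‖)) := by
        refine mul_le_mul_of_nonneg_left (h1.trans ?_) ha0
        gcongr
    _ = ε * ‖v - zs‖ * (a ^ 2 / (a ^ 2 + 1)) := by ring
    _ ≤ ε * ‖v - zs‖ * 1 := by
        gcongr
        exact (div_le_one (by positivity)).2 (by linarith)
    _ = _ := mul_one _

theorem StronglySemismooth.gradient_dualSmooth (hσ : 0 < σ) (hf : StrongConvexOn univ σ f)
    (hss : StronglySemismooth (gradConj f)) (A : Matrix (Fin m) (Fin n) ℝ)
    (b zs : EuclideanSpace ℝ (Fin m)) :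
    ∃ C δ : ℝ, 0 ≤ C ∧ 0 < δ ∧ ∀ v, ‖v - zs‖ < δ → ∀ H ∈ genHessian f A v,
      ‖gradient (dualSmooth f A b) v - gradient (dualSmooth f A b) zs -
        Matrix.toEuclideanLin H (v - zs)‖ ≤ C * ‖v - zs‖ ^ 2 := by
  set a := √(∑ i, ∑ j, A i j ^ 2) with ha
  have ha0 : 0 ≤ a := Real.sqrt_nonneg _
  obtain ⟨C, δ, hδ, h⟩ := hss.2.2 (-(Matrix.toEuclideanLin A.transpose zs))
  refine ⟨a * (|C| * a ^ 2), δ / (a + 1), by positivity, by positivity, ?_⟩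
  rintro v hv _ ⟨Q, hQ, rfl⟩
  have h1 := h _ (norm_neg_transpose_lt hv) Q (mem_clarkeJacobian_shift hQ)
  have h2 := norm_toEuclideanLin_transpose_le A (v - zs)
  rw [norm_neg] at h1
  refine (norm_gradient_remainder_le hσ hf b v zs Q).trans ?_
  calc _ ≤ a * (|C| * (a * ‖v - zs‖) ^ 2) := by
        refine mul_le_mul_of_nonneg_left (h1.trans ?_) ha0
        gcongr
        exact le_abs_self C
    _ = _ := by ring

theorem keepOn_sub_of_supp {v zs : EuclideanSpace ℝ (Fin m)} (hv : ∀ i ∉ supp zs, v i = 0) :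
    keepOn (supp zs) (v - zs) = v - zs := by
  ext i
  by_cases hi : i ∈ supp zs
  · simp [keepOn, hi]
  · have : zs i = 0 := by simpa [supp] using hi
    simp [keepOn, hi, hv i hi, this]

theorem inner_eq_zero_of_supp {v zs g : EuclideanSpace ℝ (Fin m)} (hv : ∀ i ∉ supp zs, v i = 0)
    (hg : ∀ i ∈ supp zs, g i = 0) : inner ℝ g (v - zs) = 0 := by
  rw [PiLp.inner_apply]
  refine Finset.sum_eq_zero fun i _ => ?_
  by_cases hi : i ∈ supp zs
  · simp [hg i hi]
  · have : zs i = 0 := by simpa [supp] using hi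
    simp [hv i hi, this]

/-- Error bound for a full regularized Newton step. -/
theorem norm_newton_sub_le (hσ : 0 < σ) (hf : StrongConvexOn univ σ f) (hγ : 0 < γ)
    {zs v d : EuclideanSpace ℝ (Fin m)} {ε η₃ η₄ : ℝ} (hE : EigenvalueBounds f A zs ε η₃ η₄)
    (hgrad : ∀ i ∈ supp zs, gradient (dualSmooth f A b) zs i = 0)
    (hvε : ‖v - zs‖ < ε) (hv : ∀ i ∉ supp zs, v i = 0) {H : Matrix (Fin m) (Fin m) ℝ}
    (hH : H ∈ genHessian f A v) (hd : NewtonEq f A b γ (supp zs) H v d) :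
    ‖keepOn (supp zs) (v + d - zs)‖ ≤
      (‖gradient (dualSmooth f A b) v - gradient (dualSmooth f A b) zs -
        Matrix.toEuclideanLin H (v - zs)‖ + γ * lipConst A σ * ‖v - zs‖ ^ 2) / η₃ := by
  set S := supp zs
  set g := gradient (dualSmooth f A b)
  set r := g v - g zs - Matrix.toEuclideanLin H (v - zs) with hr
  set M := submat S H
  set lam := γ * ‖subvec S (g v)‖ with hlam
  set p := subvec S (v + d - zs) with hp
  have hgs : subvec S (g zs) = 0 := by
    ext i
    exact hgrad i i.2
  have hgv : ‖subvec S (g v)‖ ≤ lipConst A σ * ‖v - zs‖ := by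
    calc ‖subvec S (g v)‖ = ‖subvec S (g v - g zs)‖ := by rw [subvec_sub, hgs, sub_zero]
      _ ≤ ‖g v - g zs‖ := norm_subvec_le S _
      _ ≤ _ := norm_gradient_dualSmooth_sub_le hσ hf A b v zs
  have hlam0 : 0 ≤ lam := by positivity
  have hpe : p = subvec S d + subvec S (v - zs) := by
    rw [hp, ← subvec_add]
    congr 1
    abel
  have hMe : Matrix.toEuclideanLin M (subvec S (v - zs)) =
      subvec S (Matrix.toEuclideanLin H (v - zs)) := by
    rw [toEuclideanLin_submat, extendZero_subvec, keepOn_sub_of_supp hv]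
  have hNewton : Matrix.toEuclideanLin M (subvec S d) + lam • subvec S d = -subvec S (g v) := by
    have h1 : Matrix.toEuclideanLin (M + lam • (1 : Matrix S S ℝ)) (subvec S d) =
      -subvec S (g v) := hd
    rw [map_add, map_smul] at h1
    simpa using h1
  -- Since ∇h(zs) vanishes on S, the Newton equation becomes (M + λI)p = λ(v - zs)_S - r_S for the
  -- error p. As λ = O(‖v - zs‖), the regularization contributes only a quadratic term.
  have hres : Matrix.toEuclideanLin M p + lam • p = lam • subvec S (v - zs) - subvec S r := by
    rw [← eq_sub_iff_add_eq] at hNewton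
    rw [hr, subvec_sub S (g v - g zs), subvec_sub S (g v), hgs, sub_zero, hpe, map_add, hMe,
      smul_add, hNewton]
    abel
  have h1 := hE.le_inner hσ hf (by simpa [dist_eq_norm] using hvε) hH p
  have h2 : inner ℝ p (Matrix.toEuclideanLin M p) ≤
      ‖p‖ * (‖r‖ + γ * lipConst A σ * ‖v - zs‖ ^ 2) := by
    calc _ ≤ inner ℝ p (Matrix.toEuclideanLin M p) + lam * ‖p‖ ^ 2 :=
          le_add_of_nonneg_right (by positivity)
      _ = inner ℝ p (lam • subvec S (v - zs) - subvec S r) := by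
          rw [← hres, inner_add_right, inner_smul_right, real_inner_self_eq_norm_sq]
      _ ≤ ‖p‖ * ‖lam • subvec S (v - zs) - subvec S r‖ := real_inner_le_norm _ _
      _ ≤ ‖p‖ * (‖r‖ + γ * lipConst A σ * ‖v - zs‖ ^ 2) := by
          gcongr
          calc _ ≤ ‖lam • subvec S (v - zs)‖ + ‖subvec S r‖ := norm_sub_le _ _
            _ ≤ lam * ‖v - zs‖ + ‖r‖ := by
                rw [norm_smul, Real.norm_of_nonneg hlam0]
                gcongr
                · exact norm_subvec_le S _
                · exact norm_subvec_le S _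
            _ ≤ γ * (lipConst A σ * ‖v - zs‖) * ‖v - zs‖ + ‖r‖ := by
                rw [hlam]
                gcongr
            _ = _ := by ring
  have hη : 0 < η₃ := hE.2.1
  rw [norm_keepOn, ← hp, le_div_iff₀ hη]
  have h3 : η₃ * ‖p‖ ^ 2 ≤ ‖p‖ * (‖r‖ + γ * lipConst A σ * ‖v - zs‖ ^ 2) := h1.trans h2
  rcases (norm_nonneg p).eq_or_lt with h0 | h0
  · rw [← h0, zero_mul]
    have := lipConst_nonneg hσ A
    positivity
  · refine le_of_mul_le_mul_left ?_ h0
    linarith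

/-- Quadratic growth of the smooth part on the support of a stationary point. -/
theorem dualSmooth_growth (hσ : 0 < σ) (hf : StrongConvexOn univ σ f)
    (hss : Semismooth (gradConj f)) {zs : EuclideanSpace ℝ (Fin m)} {ε η₃ η₄ : ℝ}
    (hE : EigenvalueBounds f A zs ε η₃ η₄)
    (hgrad : ∀ i ∈ supp zs, gradient (dualSmooth f A b) zs i = 0) {κ : ℝ} (hκ : 0 < κ) :
    ∃ δ : ℝ, 0 < δ ∧ ∀ v : EuclideanSpace ℝ (Fin m), (∀ i ∉ supp zs, v i = 0) → ‖v - zs‖ < δ →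
      dualSmooth f A b zs + (η₃ - κ) / 2 * ‖v - zs‖ ^ 2 ≤ dualSmooth f A b v := by
  obtain ⟨δ, hδ, h⟩ := hss.gradient_dualSmooth hσ hf A b zs hκ
  refine ⟨min δ ε, lt_min hδ hE.1, fun v hv hvδ => ?_⟩
  set e := v - zs with he
  set h' := dualSmooth f A b
  -- Growth follows once h minus the quadratic is nondecreasing on the segment from zs to v.
  have hder : ∀ t : ℝ, HasDerivAt (fun t : ℝ => h' (zs + t • e) - (η₃ - κ) / 2 * ‖e‖ ^ 2 * t ^ 2)
      (inner ℝ (gradient h' (zs + t • e)) e - (η₃ - κ) / 2 * ‖e‖ ^ 2 * (2 * t)) t := by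
    intro t
    have h1 := (hasGradientAt_dualSmooth hσ hf A b (zs + t • e)).hasFDerivAt
    rw [← gradient_dualSmooth hσ hf] at h1
    have h2 : HasDerivAt (fun t : ℝ => zs + t • e) e t := by
      simpa using ((hasDerivAt_id t).smul_const e).const_add zs
    have h3 := h1.comp_hasDerivAt t h2
    have h4 := ((hasDerivAt_id t).pow 2).const_mul ((η₃ - κ) / 2 * ‖e‖ ^ 2)
    refine (h3.sub h4).congr_deriv ?_
    rw [InnerProductSpace.toDual_apply_apply]
    simp [h']
  have hnonneg : ∀ t ∈ Icc (0 : ℝ) 1,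
      0 ≤ inner ℝ (gradient h' (zs + t • e)) e - (η₃ - κ) / 2 * ‖e‖ ^ 2 * (2 * t) := by
    intro t ht
    set w := zs + t • e with hw
    have hwe : w - zs = t • e := by rw [hw, add_sub_cancel_left]
    have hwn : ‖w - zs‖ = t * ‖e‖ := by rw [hwe, norm_smul, Real.norm_of_nonneg ht.1]
    have hwlt : ‖w - zs‖ < min δ ε := by
      rw [hwn]
      exact (mul_le_of_le_one_left (norm_nonneg _) ht.2).trans_lt hvδ
    -- Any H at w serves: semismoothness gives ∇h(w) - ∇h(zs) ≈ H(te), the eigenvalue bound makes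
    -- the main term at least tη₃‖e‖², and the remainder costs at most tκ‖e‖².
    obtain ⟨H, hH⟩ := genHessian_nonempty hσ hf A w
    have h1 := h w (hwlt.trans_le (min_le_left _ _)) H hH
    have h2 := hE.le_inner hσ hf
      (by simpa [dist_eq_norm] using hwlt.trans_le (min_le_right _ _)) hH (subvec (supp zs) e)
    rw [toEuclideanLin_submat, ← inner_extendZero, ← norm_keepOn, extendZero_subvec, he,
      keepOn_sub_of_supp hv, ← he] at h2
    have h3 : inner ℝ (gradient h' zs) e = 0 := inner_eq_zero_of_supp hv hgrad
    have h4 := real_inner_le_norm (-(gradient h' w - gradient h' zs -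
      Matrix.toEuclideanLin H (w - zs))) e
    rw [norm_neg, inner_neg_left, inner_sub_left, inner_sub_left, h3, hwe, map_smul,
      inner_smul_left, real_inner_comm e (Matrix.toEuclideanLin H e)] at h4
    rw [hwn, hwe, map_smul] at h1
    simp only [conj_trivial] at h4
    have h5 := mul_le_mul_of_nonneg_right h1 (norm_nonneg e)
    have h6 := mul_le_mul_of_nonneg_left h2 ht.1
    linarith
  have hmono : MonotoneOn (fun t : ℝ => h' (zs + t • e) - (η₃ - κ) / 2 * ‖e‖ ^ 2 * t ^ 2)
      (Icc 0 1) := by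
    refine monotoneOn_of_deriv_nonneg (convex_Icc 0 1)
      (fun t _ => (hder t).continuousAt.continuousWithinAt)
      (fun t _ => (hder t).differentiableAt.differentiableWithinAt) fun t ht => ?_
    rw [(hder t).deriv]
    exact hnonneg t (interior_subset ht)
  have := hmono (left_mem_Icc.2 zero_le_one) (right_mem_Icc.2 zero_le_one) zero_le_one
  simp only [zero_smul, add_zero, one_smul] at this
  rw [he, add_sub_cancel] at this
  linarith

theorem stepLength_eq_one {T : Finset (Fin m)} {v d : EuclideanSpace ℝ (Fin m)}
    (h : ∀ i ∈ T, 0 ≤ v i + d i) : stepLength T v d = 1 := by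
  refine min_eq_left ?_
  split_ifs with hN
  · refine Finset.le_inf' hN _ fun i hi => ?_
    obtain ⟨hiT, hdi⟩ := Finset.mem_filter.1 hi
    rw [le_div_iff_of_neg hdi]
    linarith [h i hiT]
  · exact le_rfl

end LocalConvergence

/-! ### Acceptance of full Newton steps and contraction near the limit. -/

section LocalConvergence

variable {m n : ℕ} {f : EuclideanSpace ℝ (Fin n) → ℝ} {σ : ℝ}
  {A : Matrix (Fin m) (Fin n) ℝ} {b : EuclideanSpace ℝ (Fin m)} {μ τ c₁ c₂ γ : ℝ}

/-- Near a stationary point, a point of the same support that is much closer to it is accepted. -/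
theorem accepted_of_norm_le (hσ : 0 < σ) (hf : StrongConvexOn univ σ f) (hμ : 0 < μ)
    {zs v w : EuclideanSpace ℝ (Fin m)} {η θ : ℝ} (hη : 0 < η)
    (hc₁ : c₁ ≤ η / 4) (hc₂ : 1 ≤ c₂)
    (hgrad : ∀ i ∈ supp zs, gradient (dualSmooth f A b) zs i = 0)
    (hv0 : ∀ i, 0 ≤ v i) (hvS : supp v = supp zs) (hw0 : ∀ i, 0 ≤ w i)
    (hwS : ∀ i ∉ supp zs, w i = 0)
    (hgrow : dualSmooth f A b zs + (η - η / 8) / 2 * ‖v - zs‖ ^ 2 ≤ dualSmooth f A b v)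
    (hw : ‖w - zs‖ ≤ θ * ‖v - zs‖) (hθ0 : 0 < θ) (hθ8 : θ ≤ 1 / 8) (hθη : θ ≤ η / 5)
    (hθℓ : lipConst A σ * θ ≤ 1 / 2) : Accepted f A b μ c₁ c₂ (supp zs) v w := by
  have hℓ := lipConst_nonneg hσ A
  have hup : ‖w - v‖ ≤ (1 + θ) * ‖v - zs‖ := by
    calc ‖w - v‖ = ‖(w - zs) - (v - zs)‖ := by rw [sub_sub_sub_cancel_right]
      _ ≤ ‖w - zs‖ + ‖v - zs‖ := norm_sub_le _ _
      _ ≤ _ := by linarith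
  have hlow : (1 - θ) * ‖v - zs‖ ≤ ‖w - v‖ := by
    have h1 : ‖v - zs‖ ≤ ‖w - zs‖ + ‖w - v‖ := by
      calc ‖v - zs‖ = ‖(w - zs) - (w - v)‖ := by rw [sub_sub_sub_cancel_left]
        _ ≤ _ := norm_sub_le _ _
    linarith
  set r := ‖v - zs‖
  have hr : 0 ≤ r := norm_nonneg _
  constructor
  · rw [dualObj_of_nonneg A b μ hv0, dualObj_of_nonneg A b μ hw0]
    have h1 := dualSmooth_le hσ hf A b zs w
    rw [inner_eq_zero_of_supp hwS hgrad] at h1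
    have h2 : ((supp w).card : ℝ) ≤ (supp v).card := by
      rw [hvS]
      exact_mod_cast Finset.card_le_card fun i hi => by
        by_contra h
        exact mem_supp.1 hi (hwS i h)
    have h3 := mul_le_mul_of_nonneg_left h2 hμ.le
    -- Growth supplies (7/16)ηr². The decrease test needs at most (81/256)ηr², and h(w) - h(zs) at
    -- most (1/20)ηr²; together these stay below 7/16.
    have h4 : c₁ * ‖w - v‖ ^ 2 ≤ η / 4 * ((1 + 1 / 8) * r) ^ 2 := by
      gcongr
      exact hup.trans (by gcongr)
    have h5 : lipConst A σ / 2 * ‖w - zs‖ ^ 2 ≤ η / 20 * r ^ 2 := by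
      calc _ ≤ lipConst A σ / 2 * (θ * r) ^ 2 := by gcongr
        _ = lipConst A σ * θ * θ / 2 * r ^ 2 := by ring
        _ ≤ 1 / 2 * (η / 5) / 2 * r ^ 2 := by gcongr
        _ = _ := by ring
    have h6 : 0 ≤ η * r ^ 2 := by positivity
    have : realObj f A b μ w + c₁ * ‖w - v‖ ^ 2 ≤ realObj f A b μ v := by
      simp only [realObj]
      nlinarith
    exact_mod_cast this
  · have hgs : subvec (supp zs) (gradient (dualSmooth f A b) zs) = 0 := by
      ext i
      exact hgrad i i.2
    calc ‖subvec (supp zs) (gradient (dualSmooth f A b) w)‖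
        = ‖subvec (supp zs) (gradient (dualSmooth f A b) w - gradient (dualSmooth f A b) zs)‖ := by
          rw [subvec_sub, hgs, sub_zero]
      _ ≤ lipConst A σ * ‖w - zs‖ :=
          (norm_subvec_le _ _).trans (norm_gradient_dualSmooth_sub_le hσ hf A b w zs)
      _ ≤ lipConst A σ * (θ * r) := by gcongr
      _ = lipConst A σ * θ * r := by ring
      _ ≤ 1 / 2 * r := by gcongr
      _ ≤ (1 - θ) * r := by gcongr; linarith
      _ ≤ ‖w - v‖ := hlow
      _ ≤ c₂ * ‖w - v‖ := le_mul_of_one_le_left (norm_nonneg _) hc₂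

/-- On the support v - zs = (z - zs) - τ(∇h(z) - ∇h(zs)), because the gradient at zs vanishes there;
hence the factor 1 + τℓ_h < 2. -/
theorem norm_proxStep_sub_le (hσ : 0 < σ) (hf : StrongConvexOn univ σ f) (hτ : 0 < τ)
    (hτ' : τ * lipConst A σ < 1) {z zs : EuclideanSpace ℝ (Fin m)}
    (hgrad : ∀ i ∈ supp zs, gradient (dualSmooth f A b) zs i = 0)
    (hT : activeSet f A b μ τ z = supp zs) :
    ‖proxStep f A b μ τ z - zs‖ ≤ 2 * ‖z - zs‖ := by
  have e : proxStep f A b μ τ z - zs = keepOn (supp zs) ((z - zs) -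
      τ • (gradient (dualSmooth f A b) z - gradient (dualSmooth f A b) zs)) := by
    ext i
    by_cases hi : i ∈ supp zs
    · have h1 := hgrad i hi
      simp only [proxStep, hT, keepOn, hi, gradStep, PiLp.sub_apply, PiLp.smul_apply, if_true,
        smul_eq_mul, h1]
      ring
    · have h1 : zs i = 0 := by simpa [supp] using hi
      simp [proxStep, hT, keepOn, hi, h1]
  rw [e, norm_keepOn]
  calc _ ≤ ‖(z - zs) - τ • (gradient (dualSmooth f A b) z - gradient (dualSmooth f A b) zs)‖ :=
        norm_subvec_le _ _
    _ ≤ ‖z - zs‖ + τ * ‖gradient (dualSmooth f A b) z - gradient (dualSmooth f A b) zs‖ := by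
        refine (norm_sub_le _ _).trans_eq ?_
        rw [norm_smul, Real.norm_of_nonneg hτ.le]
    _ ≤ ‖z - zs‖ + τ * (lipConst A σ * ‖z - zs‖) := by
        gcongr
        exact norm_gradient_dualSmooth_sub_le hσ hf A b z zs
    _ ≤ 2 * ‖z - zs‖ := by
        have := mul_le_mul_of_nonneg_right hτ'.le (norm_nonneg (z - zs))
        linarith

/-- Near a point satisfying the second-order condition, every iteration is a full Newton step with
the corresponding error bound. -/
theorem exists_step_error_bound (hσ : 0 < σ) (hf : StrongConvexOn univ σ f) (hμ : 0 < μ)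
    (hτ : 0 < τ) (hγ : 0 < γ) (hss : Semismooth (gradConj f))
    {zs : EuclideanSpace ℝ (Fin m)} {ε η₃ η₄ : ℝ} (hE : EigenvalueBounds f A zs ε η₃ η₄)
    (hthr : ∀ i ∈ supp zs, √(2 * τ * μ) ≤ zs i)
    (hgrad : ∀ i ∈ supp zs, gradient (dualSmooth f A b) zs i = 0)
    (hc₁ : c₁ ≤ η₃ / 4) (hc₂ : 1 ≤ c₂) :
    ∃ δ : ℝ, 0 < δ ∧ ∀ z z' : EuclideanSpace ℝ (Fin m), Step f A b μ τ c₁ c₂ γ z z' →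
      ‖proxStep f A b μ τ z - zs‖ < δ →
      activeSet f A b μ τ z = supp zs ∧ ∃ H ∈ genHessian f A (proxStep f A b μ τ z),
        ‖z' - zs‖ ≤ (‖gradient (dualSmooth f A b) (proxStep f A b μ τ z) -
          gradient (dualSmooth f A b) zs -
          Matrix.toEuclideanLin H (proxStep f A b μ τ z - zs)‖ +
          γ * lipConst A σ * ‖proxStep f A b μ τ z - zs‖ ^ 2) / η₃ := by
  have hℓ := lipConst_nonneg hσ A
  have hη : 0 < η₃ := hE.2.1
  have hs : 0 < √(2 * τ * μ) := by positivity
  -- θ is the relative Newton error allowed by the acceptance criterion; the semismooth remainder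
  -- and the regularization each get half of it.
  obtain ⟨θ, hθ0, hθ⟩ : ∃ θ : ℝ, 0 < θ ∧
      θ ≤ min (min (1 / 8) (η₃ / 5)) (1 / (2 * (lipConst A σ + 1))) :=
    ⟨_, lt_min (lt_min (by norm_num) (by positivity)) (by positivity), le_rfl⟩
  have hθ8 : θ ≤ 1 / 8 := hθ.trans ((min_le_left _ _).trans (min_le_left _ _))
  have hθη : θ ≤ η₃ / 5 := hθ.trans ((min_le_left _ _).trans (min_le_right _ _))
  have hθℓ : lipConst A σ * θ ≤ 1 / 2 := by
    have h1 := hθ.trans (min_le_right _ _)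
    rw [le_div_iff₀ (by positivity)] at h1
    linarith
  obtain ⟨δ₁, hδ₁, hrem⟩ := hss.gradient_dualSmooth hσ hf A b zs
    (show 0 < θ * η₃ / 2 by positivity)
  obtain ⟨δ₂, hδ₂, hgrow⟩ := dualSmooth_growth (b := b) hσ hf hss hE hgrad
    (show 0 < η₃ / 8 by positivity)
  set δ₃ := θ * η₃ / (2 * (γ * lipConst A σ + 1)) with hδ₃
  have hδ₃0 : 0 < δ₃ := by positivity
  refine ⟨min (min (min δ₁ δ₂) (min ε (√(2 * τ * μ)))) δ₃, by
    simp only [lt_min_iff]; exact ⟨⟨⟨hδ₁, hδ₂⟩, hE.1, hs⟩, hδ₃0⟩, ?_⟩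
  rintro z z' ⟨H, hH, d, hd, hacc, -⟩ hv
  simp only [lt_min_iff] at hv
  obtain ⟨⟨⟨hv1, hv2⟩, hvε, hvs⟩, hv3⟩ := hv
  have hT := activeSet_eq_supp hthr hvs
  refine ⟨hT, H, hH, ?_⟩
  rw [hT] at hd hacc
  have hvpos : ∀ i ∈ supp zs, proxStep f A b μ τ z i ≠ 0 := fun i hi => by
    rw [← hT] at hi
    rw [proxStep_apply_of_mem hi]
    exact (hs.trans (mem_activeSet.1 hi)).ne'
  have hvzero : ∀ i ∉ supp zs, proxStep f A b μ τ z i = 0 := fun i hi =>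
    proxStep_apply_of_notMem (by rwa [hT])
  have hv0 : ∀ i, 0 ≤ proxStep f A b μ τ z i := proxStep_nonneg
  set v := proxStep f A b μ τ z
  have hvS : supp v = supp zs := by
    ext i
    exact ⟨fun hi => by_contra fun h => mem_supp.1 hi (hvzero i h),
      fun hi => mem_supp.2 (hvpos i hi)⟩
  have hnewton := norm_newton_sub_le hσ hf hγ hE hgrad hvε hvzero hH hd
  have hsmall : ‖keepOn (supp zs) (v + d - zs)‖ ≤ θ * ‖v - zs‖ := by
    refine hnewton.trans ((div_le_iff₀ hη).2 ?_)
    have h1 := hrem v hv1 H hH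
    have h2 : γ * lipConst A σ * ‖v - zs‖ ^ 2 ≤ θ * η₃ / 2 * ‖v - zs‖ := by
      rw [pow_two, ← mul_assoc]
      gcongr
      rw [hδ₃, lt_div_iff₀ (by positivity)] at hv3
      linarith [norm_nonneg (v - zs)]
    linarith
  -- The full Newton point is within √(2τμ) of zs, whose entries on S are at least that large. It is
  -- therefore nonnegative, and the step length is 1.
  have hlt : ‖keepOn (supp zs) (v + d - zs)‖ < √(2 * τ * μ) :=
    (hsmall.trans (mul_le_of_le_one_left (norm_nonneg _) (by linarith))).trans_lt hvs
  have hpos : ∀ i ∈ supp zs, 0 ≤ v i + d i := fun i hi => by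
    have h1 : keepOn (supp zs) (v + d - zs) i = v i + d i - zs i := by simp [keepOn, hi]
    have h2 := (PiLp.norm_apply_le (keepOn (supp zs) (v + d - zs)) i).trans_lt hlt
    rw [h1, Real.norm_eq_abs] at h2
    have := (abs_lt.1 h2).1
    linarith [hthr i hi]
  have hw : newtonStep (supp zs) v d = keepOn (supp zs) (v + d) := by
    rw [newtonStep, stepLength_eq_one hpos, one_smul]
  have hwzero : ∀ i ∉ supp zs, newtonStep (supp zs) v d i = 0 := fun i hi => by
    simp [newtonStep, keepOn, hi]
  have hwsub : newtonStep (supp zs) v d - zs = keepOn (supp zs) (v + d - zs) := by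
    rw [← keepOn_sub_of_supp hwzero, hw]
    ext i
    by_cases hi : i ∈ supp zs <;> simp [keepOn, hi]
  have hw0 : ∀ i, 0 ≤ newtonStep (supp zs) v d i := fun i => by
    by_cases hi : i ∈ supp zs
    · rw [hw]
      simpa [keepOn, hi] using hpos i hi
    · rw [hwzero i hi]
  rw [hacc (accepted_of_norm_le hσ hf hμ hη hc₁ hc₂ hgrad hv0 hvS hw0 hwzero
    (hgrow v hvzero hv2) (by rwa [hwsub]) hθ0 hθ8 hθη hθℓ), hwsub]
  exact hnewton

/-- Near a point satisfying the second-order condition, the iteration contracts by any prescribed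
factor. -/
theorem exists_step_contraction (hσ : 0 < σ) (hf : StrongConvexOn univ σ f) (hμ : 0 < μ)
    (hτ : 0 < τ) (hτ' : τ * lipConst A σ < 1) (hγ : 0 < γ) (hss : Semismooth (gradConj f))
    {zs : EuclideanSpace ℝ (Fin m)} {ε η₃ η₄ : ℝ} (hE : EigenvalueBounds f A zs ε η₃ η₄)
    (hthr : ∀ i ∈ supp zs, √(2 * τ * μ) ≤ zs i)
    (hgrad : ∀ i ∈ supp zs, gradient (dualSmooth f A b) zs i = 0)
    (hc₁ : c₁ ≤ η₃ / 4) (hc₂ : 1 ≤ c₂) {θ : ℝ} (hθ : 0 < θ) :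
    ∃ δ : ℝ, 0 < δ ∧ ∀ z z' : EuclideanSpace ℝ (Fin m), Step f A b μ τ c₁ c₂ γ z z' →
      ‖proxStep f A b μ τ z - zs‖ < δ → ‖z' - zs‖ ≤ θ * ‖z - zs‖ := by
  have hℓ := lipConst_nonneg hσ A
  have hη : 0 < η₃ := hE.2.1
  obtain ⟨δ₁, hδ₁, hstep⟩ := exists_step_error_bound (b := b) hσ hf hμ hτ hγ hss hE hthr hgrad
    hc₁ hc₂
  -- Two error terms of size θη₃/4 times ‖v - zs‖, with ‖v - zs‖ ≤ 2‖z - zs‖, add up to θη₃‖z - zs‖.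
  obtain ⟨δ₂, hδ₂, hrem⟩ := hss.gradient_dualSmooth hσ hf A b zs
    (show 0 < θ * η₃ / 4 by positivity)
  refine ⟨min (min δ₁ δ₂) (θ * η₃ / (4 * (γ * lipConst A σ + 1))), by positivity,
    fun z z' hzz hv => ?_⟩
  simp only [lt_min_iff] at hv
  obtain ⟨⟨hv1, hv2⟩, hv3⟩ := hv
  obtain ⟨hT, H, hH, hle⟩ := hstep z z' hzz hv1
  have hprox := norm_proxStep_sub_le hσ hf hτ hτ' hgrad hT
  set v := proxStep f A b μ τ z
  refine hle.trans ((div_le_iff₀ hη).2 ?_)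
  have h1 := hrem v hv2 H hH
  have h2 : γ * lipConst A σ * ‖v - zs‖ ^ 2 ≤ θ * η₃ / 4 * ‖v - zs‖ := by
    rw [pow_two, ← mul_assoc]
    gcongr
    rw [lt_div_iff₀ (by positivity)] at hv3
    linarith [norm_nonneg (v - zs)]
  have h3 := mul_le_mul_of_nonneg_left hprox (show 0 ≤ θ * η₃ by positivity)
  linarith

/-- In the strongly semismooth case, the iteration contracts quadratically. -/
theorem exists_step_quadratic (hσ : 0 < σ) (hf : StrongConvexOn univ σ f) (hμ : 0 < μ)
    (hτ : 0 < τ) (hτ' : τ * lipConst A σ < 1) (hγ : 0 < γ) (hss : Semismooth (gradConj f))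
    (hsss : StronglySemismooth (gradConj f))
    {zs : EuclideanSpace ℝ (Fin m)} {ε η₃ η₄ : ℝ} (hE : EigenvalueBounds f A zs ε η₃ η₄)
    (hthr : ∀ i ∈ supp zs, √(2 * τ * μ) ≤ zs i)
    (hgrad : ∀ i ∈ supp zs, gradient (dualSmooth f A b) zs i = 0)
    (hc₁ : c₁ ≤ η₃ / 4) (hc₂ : 1 ≤ c₂) :
    ∃ C δ : ℝ, 0 < δ ∧ ∀ z z' : EuclideanSpace ℝ (Fin m), Step f A b μ τ c₁ c₂ γ z z' →
      ‖proxStep f A b μ τ z - zs‖ < δ → ‖z' - zs‖ ≤ C * ‖z - zs‖ ^ 2 := by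
  have hℓ := lipConst_nonneg hσ A
  have hη : 0 < η₃ := hE.2.1
  obtain ⟨δ₁, hδ₁, hstep⟩ := exists_step_error_bound (b := b) hσ hf hμ hτ hγ hss hE hthr hgrad
    hc₁ hc₂
  obtain ⟨C, δ₂, hC, hδ₂, hrem⟩ := hsss.gradient_dualSmooth hσ hf A b zs
  refine ⟨(C + γ * lipConst A σ) * 2 ^ 2 / η₃, min δ₁ δ₂, lt_min hδ₁ hδ₂,
    fun z z' hzz hv => ?_⟩
  obtain ⟨hv1, hv2⟩ := lt_min_iff.1 hv
  obtain ⟨hT, H, hH, hle⟩ := hstep z z' hzz hv1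
  have hprox := norm_proxStep_sub_le hσ hf hτ hτ' hgrad hT
  set v := proxStep f A b μ τ z
  have h1 := hrem v hv2 H hH
  calc ‖z' - zs‖ ≤ _ := hle
    _ ≤ (C * ‖v - zs‖ ^ 2 + γ * lipConst A σ * ‖v - zs‖ ^ 2) / η₃ := by gcongr
    _ = (C + γ * lipConst A σ) * ‖v - zs‖ ^ 2 / η₃ := by ring
    _ ≤ (C + γ * lipConst A σ) * (2 * ‖z - zs‖) ^ 2 / η₃ := by gcongr
    _ = _ := by ring

/-- An accumulation point that attracts the sequence locally is its limit. -/
theorem tendsto_of_eventually_contraction {E : Type*} [SeminormedAddCommGroup E] {z : ℕ → E}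
    {zs : E} (hacc : MapClusterPt zs atTop z) {δ : ℝ} (hδ : 0 < δ)
    (h : ∀ᶠ k in atTop, ‖z k - zs‖ < δ → ‖z (k + 1) - zs‖ ≤ 1 / 2 * ‖z k - zs‖) :
    Tendsto z atTop (𝓝 zs) := by
  obtain ⟨K, hK⟩ := eventually_atTop.1 h
  obtain ⟨N, hN, hNz⟩ : ∃ N ≥ K, ‖z N - zs‖ < δ := by
    have := (mapClusterPt_iff_frequently.1 hacc) _ (Metric.ball_mem_nhds zs hδ)
    simpa [dist_eq_norm] using frequently_atTop.1 this K
  have hbound : ∀ j, ‖z (j + N) - zs‖ ≤ (1 / 2) ^ j * ‖z N - zs‖ := by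
    intro j
    induction j with
    | zero => simp
    | succ j ih =>
      have h1 : ‖z (j + N) - zs‖ < δ := (ih.trans (mul_le_of_le_one_left (norm_nonneg _)
        (pow_le_one₀ (by norm_num) (by norm_num)))).trans_lt hNz
      have h2 := hK (j + N) (by omega) h1
      rw [show j + 1 + N = j + N + 1 by omega, pow_succ]
      linarith
  refine (tendsto_add_atTop_iff_nat N).1 (tendsto_iff_norm_sub_tendsto_zero.2 ?_)
  refine squeeze_zero (fun _ => norm_nonneg _) hbound ?_
  simpa using (tendsto_pow_atTop_nhds_zero_of_lt_one (r := (1 / 2 : ℝ)) (by norm_num)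
    (by norm_num)).mul_const ‖z N - zs‖

end LocalConvergence

end SGSN

/-! ### Assembly: from accumulation point to limit, then the rates. -/

theorem theorem4p2 {m n : ℕ}
    -- problem data: a real-valued strongly convex function, a matrix, a vector, a weight
    (f : EuclideanSpace ℝ (Fin n) → ℝ) (σ : ℝ) (hσ : 0 < σ) (hf : StrongConvexOn Set.univ σ f)
    (A : Matrix (Fin m) (Fin n) ℝ) (b : EuclideanSpace ℝ (Fin m)) (μ : ℝ) (hμ : 0 < μ)
    -- parameters of the method; the bound on `τ` is `τ < 1 / ℓ_h`, read as no bound if `ℓ_h = 0`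
    (τ c₁ c₂ γ : ℝ) (hτ : 0 < τ) (hτ' : τ * SGSN.lipConst A σ < 1)
    (hc₁ : 0 < c₁) (hc₂ : 0 < c₂) (hγ : 0 < γ)
    -- a bounded sequence of iterates
    (z : ℕ → EuclideanSpace ℝ (Fin m)) (hz : SGSN.IsSequence f A b μ τ c₁ c₂ γ z)
    (hbdd : Bornology.IsBounded (Set.range z))
    -- semismoothness, and an accumulation point satisfying the second-order condition
    (hss : SGSN.Semismooth (SGSN.gradConj f))
    (zs : EuclideanSpace ℝ (Fin m)) (hacc : MapClusterPt zs Filter.atTop z)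
    (hsosc : SGSN.SOSC f A zs) :
    (∃ ε η₃ η₄ : ℝ, SGSN.EigenvalueBounds f A zs ε η₃ η₄) ∧
    ∀ ε η₃ η₄ : ℝ, SGSN.EigenvalueBounds f A zs ε η₃ η₄ →
      c₁ ≤ η₃ / 4 → SGSN.lipConst A σ + η₄ + 1 ≤ c₂ →
      Filter.Tendsto z Filter.atTop (nhds zs) ∧
      Asymptotics.IsLittleO Filter.atTop (fun k => ‖z (k + 1) - zs‖) (fun k => ‖z k - zs‖) ∧
      (SGSN.StronglySemismooth (SGSN.gradConj f) →
        Asymptotics.IsBigO Filter.atTop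
          (fun k => ‖z (k + 1) - zs‖) (fun k => ‖z k - zs‖ ^ 2)) := by
  refine ⟨SGSN.exists_eigenvalueBounds hσ hf hsosc, fun ε η₃ η₄ hE hc₁' hc₂' => ?_⟩
  -- Near zs the gradient at the Newton point w satisfies ‖∇_S h(w)‖ ≤ ‖w - v‖, so c₂ ≥ 1 is enough
  -- for the second test.
  have hc₂1 : 1 ≤ c₂ := by linarith [SGSN.lipConst_nonneg hσ A, hE.2.2.1]
  have hsub := SGSN.tendsto_proxStep_sub hσ hf hμ hτ hτ' hc₁ hz hbdd
  have hlim : ∀ i ∈ SGSN.supp zs,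
      √(2 * τ * μ) ≤ zs i ∧ gradient (SGSN.dualSmooth f A b) zs i = 0 := by
    obtain ⟨φ, hφ, hzφ⟩ := hacc.tendsto_subseq
    refine fun i hi => SGSN.limit_of_proxStep hσ hf hτ hzφ ?_ hi
    simpa using (hsub.comp hφ.tendsto_atTop).add hzφ
  have hthr := fun i hi => (hlim i hi).1
  have hgrad := fun i hi => (hlim i hi).2
  have hcontr := fun θ (hθ : (0 : ℝ) < θ) => SGSN.exists_step_contraction (b := b) (c₂ := c₂)
    hσ hf hμ hτ hτ' hγ hss hE hthr hgrad hc₁' hc₂1 hθ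
  -- The contraction holds when v is within δ of zs. Half of δ covers ‖z^k - zs‖ and half the
  -- vanishing distance ‖v^k - z^k‖.
  have hconv : Tendsto z atTop (𝓝 zs) := by
    obtain ⟨δ, hδ, hstep⟩ := hcontr (1 / 2) (by norm_num)
    refine SGSN.tendsto_of_eventually_contraction hacc (half_pos hδ) ?_
    filter_upwards [hsub.norm.eventually_lt_const (u := δ / 2) (by simpa using half_pos hδ)] with k hk hzk
    refine hstep _ _ (hz k) ?_
    calc _ = ‖(SGSN.proxStep f A b μ τ (z k) - z k) + (z k - zs)‖ := by rw [sub_add_sub_cancel]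
      _ ≤ _ := norm_add_le _ _
      _ < δ := by linarith
  have hprox : Tendsto (fun k => ‖SGSN.proxStep f A b μ τ (z k) - zs‖) atTop (𝓝 0) := by
    rw [← tendsto_iff_norm_sub_tendsto_zero]
    simpa using hsub.add hconv
  refine ⟨hconv, Asymptotics.isLittleO_iff.2 fun θ hθ => ?_, fun hsss => ?_⟩
  · obtain ⟨δ, hδ, hstep⟩ := hcontr θ hθ
    filter_upwards [hprox.eventually_lt_const hδ] with k hk
    simpa using hstep _ _ (hz k) hk
  · obtain ⟨C, δ, hδ, hstep⟩ := SGSN.exists_step_quadratic (b := b) (c₂ := c₂)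
      hσ hf hμ hτ hτ' hγ hss hsss hE hthr hgrad hc₁' hc₂1
    refine Asymptotics.IsBigO.of_bound C ?_
    filter_upwards [hprox.eventually_lt_const hδ] with k hk
    simpa using hstep _ _ (hz k) hk
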